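/- \textbf{Conventions.} Groups act on the right, $g^h=h^{-1}gh$. For a set with equivalence relation $(X,\sim)$ write $\overline{x}$ for the class of $x$, $\overline{X}$ for the set of classes, $\mathrm{Sym}(X,\sim)$ for the group of bijections $g$ of $X$ with $x\sim y\iff xg\sim yg$, and $\overline{g}$, $\overline{U}$ for the induced action on $\overline{X}$. A \emph{local Moufang set} $\mathbb{M}$ consists of $(X,\sim)$ with $|\overline{X}|>2$ and a subgroup $U_x\le\mathrm{Sym}(X,\sim)$ for every $x\in X$ such that, with $G=\langle U_x\mid x\in X\rangle$: $\overline{U_x}=\overline{U_y}$ whenever $x\sim y$; $U_x$ fixes $x$ and acts sharply transitively on $X\setminus\overline{x}$; $\overline{U_x}$ fixes $\overline{x}$ and acts sharply transitively on $\overline{X}\setminus\{\overline{x}\}$; $U_x^g=U_{xg}$ for all $x\in X$, $g\in G$. Two local Moufang sets $(X,(U_x))$, $(Y,(V_y))$ are \emph{isomorphic} if there is a bijection $\phi\colon X\to Y$ with $x\sim x'\iff x\phi\sim x'\phi$ and $U_x\phi\subseteq\phi V_{x\phi}$ for all $x,x'\in X$. Fix points $0\nsim\infty$ of $X$. For $x\nsim\infty$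 let $\alpha_x$ be the unique element of $U_\infty$ mapping $0$ to $x$, and put $-x=0\alpha_x^{-1}$, $x+y=0\alpha_x\alpha_y$, $x-y=x+(-y)$, $x\cdot 2=2x=0\alpha_x^2$. A \emph{unit} is a point $x$ with $x\nsim0$ and $x\nsim\infty$. For a unit $x$, $\mu_x$ is the unique element of $U_0\alpha_xU_0$ that interchanges $0$ and $\infty$. Fix $\tau=\mu_t$ for some unit $t$. Consider the conditions: (R1) $(-(x\tau^{-1}))\tau=-x$ for all units $x$; (R2) $U_\infty$ is abelian; (R3) the group $\langle\mu_x\mu_y\mid x,y\text{ units}\rangle$ is abelian; (R4) if $x$ is a unit, then so is $x\cdot 2$. Assume (R1)--(R4), let $e$ be a unit, put $h_x=\mu_e\mu_x$ for units $x$, and for $x,y\in R:=X\setminus\overline{\infty}$ let \[ xR_y=\begin{cases} xh_{e+y}-xh_y-x & \text{if $y$ and $y+e$ are units},\\ -xh_{-e+y}+x+xh_y & \text{if $y$ is a unit and $y+e$ is not},\\ xh_{2e+y}-xh_{e+y}-xh_{-2e}+x & \text{if $y$ is not a unit.} \end{cases} \] Put $xy:=xR_y\cdot\tfrac12$, where $z\cdot\tfrac12$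 is the unique element $w$ of $R$ with $w\cdot2=z$. For a commutative local ring $(S,\mathfrak m)$, let $\mathbb{P}^1(S)$ be the set of pairs $(a,b)\in S^2$ with $aS+bS=S$ modulo multiplication by $S^\times$, with $[a,b]\sim[c,d]\iff ad-bc\in\mathfrak m$. Let $\mathrm{PSL}_2(S)$ act on row vectors from the right, and let $U=\left\{\begin{bmatrix}1&r\\0&1\end{bmatrix}\;\middle|\;r\in S\right\}$ and $\tau'=\begin{bmatrix}0&-1\\1&0\end{bmatrix}$. The \emph{projective local Moufang set} $\mathbb{M}(S)$ has underlying set $(\mathbb{P}^1(S),\sim)$ and, with $\infty=[0,1]$ and $0=[1,0]=\infty\tau'$, the root groups $U_\infty=U$, $U_0=U^{\tau'}$, $U_x=U_0^{\alpha_x}$ for $x\nsim\infty$ and $U_x=U_\infty^{\gamma}$ with $\gamma=\alpha_{x\tau'^{-1}}^{\tau'}$ for $x\sim\infty$, where $\alpha_x\in U$ maps $0$ to $x$. \textbf{Theorem.} Let $\mathbb{M}$ be a local Moufang set satisfying (R1)--(R4), let $e$, $R$ and $R_x$ be as above, and assume \[ x\mu_e\alpha_y = yR_x\,\alpha_{-2e}\,\mu_e\,R_x\,\mu_e\quad\text{for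 all $x\sim0$ and $y\nsim\infty$.}\tag{$\star$} \] Then $R$ with the above addition and multiplication is a commutative local ring with zero $0$ and identity $e$, $\mathbb{M}(R)$ is a local Moufang set, and $\mathbb{M}$ is isomorphic to $\mathbb{M}(R)$. -/

import Mathlib

open scoped MatrixGroups

universe u

noncomputable section

namespace LocalMoufang

/-! Groups act on the right in the mathematics, on the left in Lean: the right action `x g` is
written `g • x`, a product `g h` (first `g`, then `h`) is `h * g`, and the conjugate
`g ^ h = h⁻¹ g h` is `h * g * h⁻¹ = MulAut.conj h g`. -/

/-- `Sym(X, ∼)`: the bijections of `X` that preserve the equivalence relation `r`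
(in both directions). -/
def SymRel {X : Type u} (r : Setoid X) : Subgroup (Equiv.Perm X) where
  carrier := {g | ∀ x y, r x y ↔ r (g x) (g y)}
  mul_mem' := by
    intro a b ha hb x y
    exact (hb x y).trans (ha (b x) (b y))
  one_mem' := fun _ _ => Iff.rfl
  inv_mem' := by
    intro a ha x y
    have h := ha (a⁻¹ x) (a⁻¹ y)
    simpa using h.symm

/-- The action induced by `Sym(X, ∼)` on the set of equivalence classes. -/
def induced {X : Type u} (r : Setoid X) : SymRel r →* Equiv.Perm (Quotient r) where
  toFun g := Quotient.congr g.1 g.2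
  map_one' := by
    ext q
    induction q using Quotient.inductionOn with
    | h x => rfl
  map_mul' a b := by
    ext q
    induction q using Quotient.inductionOn with
    | h x => rfl

/-- The conjugate subgroup `H ^ g = g⁻¹ H g` (for right actions). -/
def conjBy {G : Type u} [Group G] (H : Subgroup G) (g : G) : Subgroup G :=
  H.map (MulAut.conj g).toMonoidHom

/-- The elements of `H` act sharply transitively on the set `S`. -/
def SharplyTransitiveOn {G Y : Type u} [Group G] [MulAction G Y] (H : Subgroup G)
    (S : Set Y) : Prop :=
  ∀ y ∈ S, ∀ z ∈ S, ∃! g : G, g ∈ H ∧ g • y = z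

/-- The data of a local Moufang set: an equivalence relation on `X` and, for each point, a
subgroup of `Sym(X, ∼)`. -/
structure Data (X : Type u) where
  rel : Setoid X
  U : X → Subgroup (SymRel rel)

namespace Data

variable {X : Type u} (M : Data X)

/-- The little projective group. -/
def G : Subgroup (SymRel M.rel) := ⨆ x, M.U x

/-- The permutation group induced by the root group `U x` on the set of classes. -/
def Ubar (x : X) : Subgroup (Equiv.Perm (Quotient M.rel)) := (M.U x).map (induced M.rel)

/-- The data form a local Moufang set. -/
structure IsLocalMoufangSet : Prop where
  two_lt_card : 2 < Cardinal.mk (Quotient M.rel)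
  LM0 : ∀ x y, M.rel x y → M.Ubar x = M.Ubar y
  LM1_fix : ∀ x, ∀ g ∈ M.U x, g • x = x
  LM1 : ∀ x, SharplyTransitiveOn (M.U x) {y | ¬ M.rel y x}
  LM1'_fix : ∀ x, ∀ g ∈ M.Ubar x, g • (Quotient.mk M.rel x) = Quotient.mk M.rel x
  LM1' : ∀ x, SharplyTransitiveOn (M.Ubar x) {q | q ≠ Quotient.mk M.rel x}
  LM2 : ∀ x, ∀ g ∈ M.G, conjBy (M.U x) g = M.U (g • x)

end Data

/-- For a group `U` of permutations and points `o`, `x`: the element of `U` mapping `o` to `x`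
(it is only used where it exists and is unique). -/
def alphaOf {X : Type u} {r : Setoid X} (U : Subgroup (SymRel r)) (o x : X) : SymRel r :=
  open Classical in
  if h : ∃ g : SymRel r, g ∈ U ∧ g • o = x then h.choose else 1

namespace Data

/-! Below, `(o, i)` is a basis: `o` plays the role of `0` and `i` that of `∞`. -/

variable {X : Type u} (M : Data X) (o i : X)

/-- `α_x`, the element of `U_∞` mapping `0` to `x`, for `x ≁ ∞`. -/
def alpha (x : X) : SymRel M.rel := alphaOf (M.U i) o x

/-- `-x = 0 · α_x⁻¹`. -/
def neg (x : X) : X := (M.alpha o i x)⁻¹ • o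

/-- `x + y = 0 · α_x α_y`. -/
def add (x y : X) : X := (M.alpha o i y * M.alpha o i x) • o

/-- `x - y = x + (-y)`. -/
def sub (x y : X) : X := M.add o i x (M.neg o i y)

/-- `x · k = 0 · α_x ^ k`. -/
def times (x : X) (k : ℕ) : X := (M.alpha o i x ^ k) • o

/-- `x` is a unit with respect to the basis `(o, i)`. -/
def IsUnitPt (x : X) : Prop := ¬ M.rel x o ∧ ¬ M.rel x i

/-- `m` lies in the double coset `U_0 α_x U_0` and swaps `0` and `∞`. -/
def IsMu (x : X) (m : SymRel M.rel) : Prop :=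
  (∃ g ∈ M.U o, ∃ h ∈ M.U o, m = h * M.alpha o i x * g) ∧ m • o = i ∧ m • i = o

/-- The `μ`-map `μ_x`: the element of `U_0 α_x U_0` swapping `0` and `∞`, for a unit `x`
(for which it exists and is unique in a local Moufang set). -/
def mu (x : X) : SymRel M.rel :=
  open Classical in
  if h : ∃ m, M.IsMu o i x m then h.choose else 1

/-- `∼x = (-(x τ⁻¹)) τ`. -/
def tilde (τ : SymRel M.rel) (x : X) : X := τ • M.neg o i (τ⁻¹ • x)

/-- The Hua map `h_{x,τ} = τ μ_x`. -/
def hua (τ : SymRel M.rel) (x : X) : SymRel M.rel := M.mu o i x * τ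

/-- The Hua subgroup, generated by the products `μ_x μ_y` for units `x`, `y`. -/
def huaSubgroup : Subgroup (SymRel M.rel) :=
  Subgroup.closure
    {g | ∃ x y, M.IsUnitPt o i x ∧ M.IsUnitPt o i y ∧ g = M.mu o i y * M.mu o i x}

/-- The conditions (R1)-(R4), with respect to a basis `(o, i)` and a `μ`-map `τ`. -/
structure SatisfiesR (τ : SymRel M.rel) : Prop where
  R1 : ∀ x, M.IsUnitPt o i x → M.tilde o i τ x = M.neg o i x
  R2 : ∀ a ∈ M.U i, ∀ b ∈ M.U i, a * b = b * a
  R3 : ∀ a ∈ M.huaSubgroup o i, ∀ b ∈ M.huaSubgroup o i, a * b = b * a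
  R4 : ∀ x, M.IsUnitPt o i x → M.IsUnitPt o i (M.times o i x 2)

/-- `x R_y`, where `e` is a unit and `h_z = μ_e μ_z`. -/
def Rmap (e y x : X) : X :=
  let h : X → X → X := fun z w => M.hua o i (M.mu o i e) z • w
  let e2 : X := M.times o i e 2
  open Classical in
  if M.IsUnitPt o i y then
    if M.IsUnitPt o i (M.add o i y e) then
      M.sub o i (M.sub o i (h (M.add o i e y) x) (h y x)) x
    else
      M.add o i (M.add o i (M.neg o i (h (M.add o i (M.neg o i e) y) x)) x) (h y x)
  else
    M.add o i
      (M.sub o i (M.sub o i (h (M.add o i e2 y) x) (h (M.add o i e y) x)) (h (M.neg o i e2) x)) x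

/-- `x · (1/2)`: the point `z ≁ ∞` with `z · 2 = x` (used where it exists and is unique). -/
def half (x : X) : X :=
  open Classical in
  if h : ∃ z, ¬ M.rel z i ∧ M.times o i z 2 = x then h.choose else x

/-- The product `x y = x R_y · (1/2)`. -/
def mul (e x y : X) : X := M.half o i (M.Rmap o i e y x)

/-- The underlying set `X ∖ [∞]` of the ring constructed from `M`. -/
def RingCarrier : Type u := {x : X // ¬ M.rel x i}

/-- The identity `x μ_e α_y = y R_x α_{-2e} μ_e R_x μ_e` for all `x ∼ 0` and `y ≁ ∞`. -/
def StarIdentity (e : X) : Prop :=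
  ∀ x y, M.rel x o → ¬ M.rel y i →
    M.alpha o i y • M.mu o i e • x =
      M.mu o i e • M.Rmap o i e x
        (M.mu o i e • M.alpha o i (M.neg o i (M.times o i e 2)) • M.Rmap o i e x y)

/-- A commutative ring structure on `X ∖ [∞]` is the constructed one: its operations are
`x + y = 0 · α_x α_y` and `x y = x R_y · (1/2)`, with zero `0` and identity `e`. -/
structure IsConstructedRing (e : X) [CommRing (M.RingCarrier i)] : Prop where
  add_eq : ∀ x y : M.RingCarrier i, (x + y).1 = M.add o i x.1 y.1
  mul_eq : ∀ x y : M.RingCarrier i, (x * y).1 = M.mul o i e x.1 y.1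
  zero_eq : (0 : M.RingCarrier i).1 = o
  one_eq : (1 : M.RingCarrier i).1 = e

end Data

/-- A homomorphism: `x ∼ x' ↔ x φ ∼ x' φ` and `U_x φ ⊆ φ V_{x φ}`. -/
structure IsHom {X Y : Type u} (M : Data X) (N : Data Y) (φ : X → Y) : Prop where
  rel_iff : ∀ x x', M.rel x x' ↔ N.rel (φ x) (φ x')
  map_root : ∀ x, ∀ g ∈ M.U x, ∃ v ∈ N.U (φ x), ∀ y, φ (g • y) = v • φ y

/-- Isomorphic: there is a bijective homomorphism. -/
def Isomorphic {X Y : Type u} (M : Data X) (N : Data Y) : Prop :=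
  ∃ φ : X → Y, Function.Bijective φ ∧ IsHom M N φ

/-- The construction `𝕄(U, τ)`, where `U` fixes `i` (that is, `∞`) and `0 = ∞ τ`: with
`U_∞ = U`, `U_0 = U ^ τ` and `γ_x = α_x ^ τ`, one puts `U_x = U_0 ^ α_x` for `x ≁ ∞` and
`U_x = U_∞ ^ γ_{x τ⁻¹}` for `x ∼ ∞`. -/
def construct {X : Type u} (r : Setoid X) (U : Subgroup (SymRel r)) (τ : SymRel r) (i : X) :
    Data X where
  rel := r
  U x :=
    open Classical in
    if r x i then conjBy U (τ * alphaOf U (τ • i) (τ⁻¹ • x) * τ⁻¹)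
    else conjBy (conjBy U τ) (alphaOf U (τ • i) x)

/-! The projective line over a commutative ring and its local Moufang set. -/

section Projective

variable (R : Type u) [CommRing R]

/-- Pairs `(a, b)` with `aR + bR = R`. -/
def UnimodularPair : Type u := {v : Fin 2 → R // IsCoprime (v 0) (v 1)}

/-- Two pairs are proportional by an invertible element. -/
def unitSetoid : Setoid (UnimodularPair R) where
  r v w := ∃ c : Rˣ, w.1 = (c : R) • v.1
  iseqv := by
    refine ⟨fun v => ⟨1, by simp⟩, ?_, ?_⟩
    · rintro v w ⟨c, hc⟩
      exact ⟨c⁻¹, by rw [hc, smul_smul]; simp⟩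
    · rintro v w z ⟨c, hc⟩ ⟨d, hd⟩
      exact ⟨d * c, by rw [hd, hc, smul_smul]; simp⟩

/-- The projective line `ℙ¹(R)`. -/
def P1 : Type u := Quotient (unitSetoid R)

variable {R}

/-- The point `[a, b]`. -/
def P1.mk (a b : R) (h : IsCoprime a b) : P1 R :=
  Quotient.mk (unitSetoid R) ⟨![a, b], by simpa using h⟩

/-- The right action of `SL₂(R)` on `ℙ¹(R)`, row vectors times matrices. -/
def slMap (A : SL(2, R)) : P1 R → P1 R :=
  Quotient.map
    (fun v : UnimodularPair R =>
      (⟨Matrix.vecMul v.1 A.1, v.2.vecMulSL A⟩ : UnimodularPair R))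
    (by
      rintro v w ⟨c, hc⟩
      exact ⟨c, by simp only [hc, Matrix.smul_vecMul]⟩)

theorem slMap_one (p : P1 R) : slMap (1 : SL(2, R)) p = p := by
  induction p using Quotient.inductionOn with
  | h v =>
    apply Quotient.sound
    exact ⟨1, by simp⟩

theorem slMap_mul (A B : SL(2, R)) (p : P1 R) : slMap (A * B) p = slMap B (slMap A p) := by
  induction p using Quotient.inductionOn with
  | h v =>
    apply Quotient.sound
    exact ⟨1, by simp [Matrix.vecMul_vecMul]⟩

variable (R) [IsLocalRing R]

/-- The equivalence on `ℙ¹(R)`: `[a, b] ∼ [c, d]` if and only if `ad - bc` lies in the maximal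
ideal, that is, the two points have the same reduction over the residue field. The three theorems
below make it explicit on the representatives `[1, r]` and `[m, 1]`. -/
def P1.rel : Setoid (P1 R) where
  r p q := Quotient.liftOn₂ p q
    (fun v w => v.1 0 * w.1 1 - v.1 1 * w.1 0 ∈ IsLocalRing.maximalIdeal R)
    (by
      rintro v w v' w' ⟨c, hc⟩ ⟨d, hd⟩
      apply propext
      have : v'.1 0 * w'.1 1 - v'.1 1 * w'.1 0
          = ((c * d : Rˣ) : R) * (v.1 0 * w.1 1 - v.1 1 * w.1 0) := by
        simp only [hc, hd, Pi.smul_apply, smul_eq_mul, Units.val_mul]; ring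
      rw [this]
      exact (Ideal.unit_mul_mem_iff_mem _ (Units.isUnit _)).symm)
  iseqv := by
    refine ⟨?_, ?_, ?_⟩
    · intro p
      induction p using Quotient.inductionOn with
      | h v =>
        change v.1 0 * v.1 1 - v.1 1 * v.1 0 ∈ _
        have : v.1 0 * v.1 1 - v.1 1 * v.1 0 = 0 := by ring
        rw [this]; exact zero_mem _
    · intro p q
      induction p, q using Quotient.inductionOn₂ with
      | h v w =>
        intro h
        change v.1 0 * w.1 1 - v.1 1 * w.1 0 ∈ _ at h
        change w.1 0 * v.1 1 - w.1 1 * v.1 0 ∈ _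
        have : w.1 0 * v.1 1 - w.1 1 * v.1 0 = -(v.1 0 * w.1 1 - v.1 1 * w.1 0) := by ring
        rw [this]; exact neg_mem h
    · intro p q s
      induction p, q, s using Quotient.inductionOn₃ with
      | h v w z =>
        intro h1 h2
        change v.1 0 * w.1 1 - v.1 1 * w.1 0 ∈ _ at h1
        change w.1 0 * z.1 1 - w.1 1 * z.1 0 ∈ _ at h2
        change v.1 0 * z.1 1 - v.1 1 * z.1 0 ∈ _
        obtain ⟨a, b, hab⟩ := w.2
        have : v.1 0 * z.1 1 - v.1 1 * z.1 0
            = (a * v.1 0 + b * v.1 1) * (w.1 0 * z.1 1 - w.1 1 * z.1 0)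
              + (a * z.1 0 + b * z.1 1) * (v.1 0 * w.1 1 - v.1 1 * w.1 0) := by
          linear_combination (-(v.1 0 * z.1 1 - v.1 1 * z.1 0)) * hab
        rw [this]
        exact add_mem (Ideal.mul_mem_left _ _ h2) (Ideal.mul_mem_left _ _ h1)

variable {R}

theorem P1.rel_affine (r s : R) :
    P1.rel R (P1.mk 1 r isCoprime_one_left) (P1.mk 1 s isCoprime_one_left) ↔
      r - s ∈ IsLocalRing.maximalIdeal R := by
  change (1 : R) * s - r * 1 ∈ IsLocalRing.maximalIdeal R ↔ _
  have : (1 : R) * s - r * 1 = -(r - s) := by ring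
  rw [this, neg_mem_iff]

theorem P1.rel_infinity (m n : R) (hm : m ∈ IsLocalRing.maximalIdeal R)
    (hn : n ∈ IsLocalRing.maximalIdeal R) :
    P1.rel R (P1.mk m 1 isCoprime_one_right) (P1.mk n 1 isCoprime_one_right) := by
  change m * 1 - 1 * n ∈ IsLocalRing.maximalIdeal R
  simpa using sub_mem hm hn

theorem P1.not_rel (m r : R) (hm : m ∈ IsLocalRing.maximalIdeal R) :
    ¬ P1.rel R (P1.mk m 1 isCoprime_one_right) (P1.mk 1 r isCoprime_one_left) := by
  change ¬ (m * r - 1 * 1 ∈ IsLocalRing.maximalIdeal R)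
  intro h
  apply (Ideal.ne_top_iff_one _).1 (IsLocalRing.maximalIdeal.isMaximal R).ne_top
  simpa using sub_mem (Ideal.mul_mem_right r _ hm) h

theorem slMap_rel (A : SL(2, R)) (p q : P1 R) :
    P1.rel R p q ↔ P1.rel R (slMap A p) (slMap A q) := by
  induction p, q using Quotient.inductionOn₂ with
  | h v w =>
    change v.1 0 * w.1 1 - v.1 1 * w.1 0 ∈ IsLocalRing.maximalIdeal R ↔
      Matrix.vecMul v.1 A.1 0 * Matrix.vecMul w.1 A.1 1
        - Matrix.vecMul v.1 A.1 1 * Matrix.vecMul w.1 A.1 0 ∈ IsLocalRing.maximalIdeal R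
    have hdet := A.2
    rw [Matrix.det_fin_two] at hdet
    have : Matrix.vecMul v.1 A.1 0 * Matrix.vecMul w.1 A.1 1
        - Matrix.vecMul v.1 A.1 1 * Matrix.vecMul w.1 A.1 0
        = v.1 0 * w.1 1 - v.1 1 * w.1 0 := by
      simp only [Matrix.vecMul, dotProduct, Fin.sum_univ_two]
      linear_combination (v.1 0 * w.1 1 - v.1 1 * w.1 0) * hdet
    rw [this]

/-- The right action of `SL₂(R)` on `(ℙ¹(R), ∼)`; a right action is a homomorphism to the opposite
of the group of permutations. -/
def slHom : SL(2, R) →* (SymRel (P1.rel R))ᵐᵒᵖ where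
  toFun A := MulOpposite.op
    ⟨{ toFun := slMap A
       invFun := slMap A⁻¹
       left_inv := fun p => by rw [← slMap_mul, mul_inv_cancel, slMap_one]
       right_inv := fun p => by rw [← slMap_mul, inv_mul_cancel, slMap_one] },
     slMap_rel A⟩
  map_one' := by
    apply MulOpposite.unop_injective
    apply Subtype.ext
    ext p
    exact slMap_one p
  map_mul' A B := by
    apply MulOpposite.unop_injective
    apply Subtype.ext
    ext p
    exact slMap_mul A B p

theorem center_le_ker_slHom : Subgroup.center SL(2, R) ≤ (slHom (R := R)).ker := by
  intro A hA
  obtain ⟨c, hc, hA⟩ := Matrix.SpecialLinearGroup.mem_center_iff.1 hA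
  rw [MonoidHom.mem_ker]
  apply MulOpposite.unop_injective
  apply Subtype.ext
  ext p
  induction p using Quotient.inductionOn with
  | h v =>
    have hc2 : c * c = 1 := by simpa [pow_two] using hc
    refine Quotient.sound (s := unitSetoid R) ⟨Units.mk c c hc2 hc2, ?_⟩
    change v.1 = c • Matrix.vecMul v.1 A.1
    rw [← hA]
    ext j
    simp [Matrix.scalar_apply]
    linear_combination (-(v.1 j)) * hc2

/-- The right action of `PSL₂(R)` on `(ℙ¹(R), ∼)`. -/
def pslHom : PSL(2, R) →* (SymRel (P1.rel R))ᵐᵒᵖ :=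
  QuotientGroup.lift _ slHom center_le_ker_slHom

/-- The matrix `(1 r; 0 1)`. -/
def upperMatrix (r : R) : SL(2, R) := ⟨!![1, r; 0, 1], by simp⟩

variable (R) in
/-- The matrix `(0 -1; 1 0)`. -/
def tauMatrix : SL(2, R) := ⟨!![0, -1; 1, 0], by simp⟩

variable (R) in
/-- The group `U` of the elements of `PSL₂(R)` represented by `(1 r; 0 1)`. -/
def upper : Subgroup PSL(2, R) where
  carrier := {g | ∃ r : R, g = QuotientGroup.mk (upperMatrix r)}
  one_mem' := ⟨0, by
    rw [← QuotientGroup.mk_one]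
    congr 1
    ext j k
    fin_cases j <;> fin_cases k <;> simp [upperMatrix]⟩
  mul_mem' := by
    rintro _ _ ⟨r, rfl⟩ ⟨s, rfl⟩
    refine ⟨s + r, ?_⟩
    rw [← QuotientGroup.mk_mul]
    congr 1
    ext j k
    rw [Matrix.SpecialLinearGroup.coe_mul]
    fin_cases j <;> fin_cases k <;> simp [upperMatrix]
  inv_mem' := by
    rintro _ ⟨r, rfl⟩
    refine ⟨-r, ?_⟩
    rw [← QuotientGroup.mk_inv]
    congr 1
    ext j k
    rw [Matrix.SpecialLinearGroup.coe_inv, Matrix.adjugate_fin_two]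
    fin_cases j <;> fin_cases k <;> simp [upperMatrix]

variable (R) in
/-- The element `τ` of `PSL₂(R)` represented by `(0 -1; 1 0)`. -/
def projTau : PSL(2, R) := QuotientGroup.mk (tauMatrix R)

variable (R) in
/-- The projective local Moufang set `𝕄(R) = 𝕄(U, τ)` on `ℙ¹(R)`, with `∞ = [0, 1]`. -/
def projective : Data (P1 R) :=
  construct (P1.rel R) ((upper R).map pslHom).unop (pslHom (projTau R)).unop
    (P1.mk 0 1 isCoprime_one_right)

end Projective

end LocalMoufang

end

noncomputable section

namespace LocalMoufang

section

variable {X : Type u}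

/-! The set `R` is an additive group because it is a copy of the abelian group `U_∞`. Write `β x`
for the element of `U_0` with `∞ ↦ x`, and let maps act from the left. Condition (R1) gives `β (-x)
= (β x)⁻¹`, hence `μ x = (β x)⁻¹ * α x * (β x)⁻¹ = α x * (β x)⁻¹ * α x`. Comparing these forms for
`b` and `a + b` yields the fundamental identity `μ_{a+b}(a) = μ_b(a) - a - 2b` (`μ_add_smul`). With
(R4) it makes `R` uniquely 2-divisible; with (R3) it makes every `μ b` an involution (`μ_mul_self`).

By (R3) the Hua maps, and so the maps `R_y`, are pairwise commuting endomorphisms of `R`. The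
fundamental identity gives `R_y(e) = 2y` (`mulEnd_one`). These two facts alone make `x * y = R_y(x)
/ 2` commutative and associative with identity `e`; additivity of `R_y` gives one distributive law,
and commutativity the other. Moreover `μ_e` is `a ↦ -a⁻¹` on units (`mul_μ_one`), and the class of
`0` is an ideal containing exactly the nonunits, so `R` is local.

Points outside the class of `∞` go to `[1, x]`, and `μ_e(x)` with `x ∼ 0` goes to `[x, -1]`. Under
this bijection `μ_e` becomes the matrix `τ'`. The only unknown is how `U_∞` acts on the class of
`∞`; (⋆) says precisely that `α y` sends `μ_e(x)` to `μ_e(x / (1 - xy))`, which is the action of the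
unipotent matrix (`star_eq`, `toP1_α_smul`). All root groups are conjugates built from `U_∞` and
`μ_e`, so they correspond too. The axioms for `𝕄(R)` are then transported from `𝕄` rather than
verified with matrices. -/

/-- A local Moufang set satisfying (R1)-(R4), with a basis `(o, i)` and a distinguished
unit `e`. -/
structure Frame (X : Type u) where
  M : Data X
  hM : M.IsLocalMoufangSet
  o : X
  i : X
  hoi : ¬ M.rel o i
  t : X
  ht : M.IsUnitPt o i t
  hR : M.SatisfiesR o i (M.mu o i t)
  e : X
  he : M.IsUnitPt o i e

namespace Frame

/-! ### Root groups and sharp transitivity. -/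

variable (F : Frame X)

/-- The group `Sym(X, ∼)`. -/
abbrev Sym : Type u := SymRel F.M.rel

theorem rel_smul (g : F.Sym) (x y : X) : F.M.rel (g • x) (g • y) ↔ F.M.rel x y :=
  (g.2 x y).symm

theorem hio : ¬ F.M.rel F.i F.o := fun h => F.hoi (F.M.rel.symm' h)

theorem smul_eq_self {x : X} {g : F.Sym} (hg : g ∈ F.M.U x) : g • x = x :=
  F.hM.LM1_fix x g hg

variable {F}

theorem rel_smul_of_mem {x : X} {g : F.Sym} (hg : g ∈ F.M.U x) (y : X) :
    F.M.rel (g • y) x ↔ F.M.rel y x := by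
  conv_lhs => rw [← F.smul_eq_self hg]
  exact F.rel_smul g y x

theorem root_ext {x y : X} {g h : F.Sym} (hg : g ∈ F.M.U x) (hh : h ∈ F.M.U x)
    (hy : ¬ F.M.rel y x) (hgh : g • y = h • y) : g = h :=
  (F.hM.LM1 x y hy (g • y) ((rel_smul_of_mem hg y).not.2 hy)).unique ⟨hg, rfl⟩ ⟨hh, hgh.symm⟩

theorem exists_root {x y z : X} (hy : ¬ F.M.rel y x) (hz : ¬ F.M.rel z x) :
    ∃ g ∈ F.M.U x, g • y = z :=
  (F.hM.LM1 x y hy z hz).exists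

theorem root_le_G (x : X) : F.M.U x ≤ F.M.G := le_iSup F.M.U x

theorem conj_mem {x : X} {g u : F.Sym} (hg : g ∈ F.M.G) (hu : u ∈ F.M.U x) :
    g * u * g⁻¹ ∈ F.M.U (g • x) := by
  rw [← F.hM.LM2 x g hg]
  exact ⟨u, hu, rfl⟩

theorem alphaOf_spec {x y z : X} (hy : ¬ F.M.rel y x) (hz : ¬ F.M.rel z x) :
    alphaOf (F.M.U x) y z ∈ F.M.U x ∧ alphaOf (F.M.U x) y z • y = z := by
  have h := exists_root hy hz
  unfold alphaOf
  rw [dif_pos h]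
  exact h.choose_spec

theorem root_comm {a b : F.Sym} (ha : a ∈ F.M.U F.i) (hb : b ∈ F.M.U F.i) : a * b = b * a :=
  F.hR.R2 a ha b hb

/-! ### The additive group of `R`. -/

variable (F) in
/-- The ring of the local Moufang set, as a set. -/
def R : Type u := F.M.RingCarrier F.i

/-- The point of `X` underlying an element of `R`. -/
def R.pt (x : F.R) : X := Subtype.val x

theorem R.not_rel (x : F.R) : ¬ F.M.rel x.pt F.i := Subtype.property x

theorem R.ext {x y : F.R} (h : x.pt = y.pt) : x = y := Subtype.ext h

variable (F) in
/-- A point not equivalent to `∞` as an element of `R`. -/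
def R.mk (p : X) (h : ¬ F.M.rel p F.i) : F.R := ⟨p, h⟩

theorem R.pt_mk {p : X} (h : ¬ F.M.rel p F.i) : (R.mk F p h).pt = p := rfl

/-- The element `α_x` of `U_∞`. -/
def α (x : F.R) : F.Sym := F.M.alpha F.o F.i x.pt

theorem α_mem (x : F.R) : α x ∈ F.M.U F.i := (alphaOf_spec F.hoi x.not_rel).1

theorem α_smul (x : F.R) : α x • F.o = x.pt := (alphaOf_spec F.hoi x.not_rel).2

theorem α_unique {x : F.R} {g : F.Sym} (hg : g ∈ F.M.U F.i) (h : g • F.o = x.pt) : g = α x :=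
  root_ext hg (α_mem x) F.hoi (h.trans (α_smul x).symm)

variable (F) in
/-- The root group `U_∞` is commutative. -/
@[reducible]
def rootCommGroup : CommGroup (F.M.U F.i) :=
  { (inferInstance : Group (F.M.U F.i)) with
    mul_comm := fun a b => Subtype.ext (root_comm a.2 b.2) }

variable (F) in
/-- The bijection `x ↦ α_x` from `R` to `U_∞`. -/
def rootEquiv : F.R ≃ Additive (F.M.U F.i) where
  toFun x := Additive.ofMul ⟨α x, α_mem x⟩
  invFun g := ⟨g.toMul.1 • F.o, (rel_smul_of_mem g.toMul.2 F.o).not.2 F.hoi⟩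
  left_inv x := Subtype.ext (α_smul x)
  right_inv g := by
    apply Additive.toMul.injective
    exact Subtype.ext (α_unique g.toMul.2 rfl).symm

instance : AddCommGroup F.R :=
  letI := rootCommGroup F
  F.rootEquiv.addCommGroup

theorem α_injective : Function.Injective (α : F.R → F.Sym) := fun x y h =>
  R.ext (by rw [← α_smul x, h, α_smul])

theorem α_add (x y : F.R) : α (x + y) = α x * α y :=
  (α_unique (mul_mem (α_mem x) (α_mem y)) rfl).symm

theorem α_zero : α (0 : F.R) = 1 := (α_unique (one_mem _) rfl).symm

theorem α_neg (x : F.R) : α (-x) = (α x)⁻¹ := (α_unique (inv_mem (α_mem x)) rfl).symm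

theorem coe_zero : (0 : F.R).pt = F.o := by rw [← α_smul, α_zero, one_smul]

theorem coe_add (x y : F.R) : (x + y).pt = α x • y.pt := by
  rw [← α_smul, α_add, mul_smul, α_smul]

theorem coe_add_eq (x y : F.R) : (x + y).pt = F.M.add F.o F.i x.pt y.pt := by
  rw [add_comm, ← α_smul, α_add]; rfl

theorem coe_neg (x : F.R) : (-x).pt = (α x)⁻¹ • F.o := by rw [← α_smul, α_neg]

theorem coe_neg_eq (x : F.R) : (-x).pt = F.M.neg F.o F.i x.pt := coe_neg x

theorem coe_sub_eq (x y : F.R) : (x - y).pt = F.M.sub F.o F.i x.pt y.pt := by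
  rw [sub_eq_add_neg, coe_add_eq, coe_neg_eq]; rfl

theorem coe_double_eq (x : F.R) : (x + x).pt = F.M.times F.o F.i x.pt 2 := by
  rw [← α_smul, α_add, ← pow_two]; rfl

/-! ### Units and the class of `0`. -/

/-- The points of `R` that are not equivalent to `0`. -/
def IsU (x : F.R) : Prop := ¬ F.M.rel x.pt F.o

theorem isUnitPt_iff (x : F.R) : F.M.IsUnitPt F.o F.i x.pt ↔ IsU x :=
  ⟨fun h => h.1, fun h => ⟨h, x.not_rel⟩⟩

theorem rel_coe_iff (x y : F.R) : F.M.rel x.pt y.pt ↔ ¬ IsU (x - y) := by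
  have hy : y.pt = α y • F.o := (α_smul y).symm
  have hx : x.pt = α y • (x - y).pt := by rw [← coe_add, add_sub_cancel]
  rw [IsU, not_not, hx, hy, rel_smul]

variable (F) in
/-- The class of `0`, as a subgroup of `R`. -/
def nonU : AddSubgroup F.R where
  carrier := {x | F.M.rel x.pt F.o}
  zero_mem' := by
    change F.M.rel (0 : F.R).pt F.o
    rw [coe_zero]
  add_mem' := by
    intro x y hx hy
    change F.M.rel (x + y).pt F.o
    rw [coe_add]
    refine F.M.rel.trans' ((F.rel_smul (α x) _ _).2 hy) ?_
    rw [α_smul]; exact hx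
  neg_mem' := by
    intro x hx
    change F.M.rel (-x).pt F.o
    rw [coe_neg, ← F.rel_smul (α x), smul_inv_smul, α_smul]
    exact F.M.rel.symm' hx

theorem mem_nonU (x : F.R) : x ∈ nonU F ↔ ¬ IsU x := not_not.symm

theorem isU_iff (x : F.R) : IsU x ↔ x ∉ nonU F := Iff.rfl

theorem IsU.neg {x : F.R} (h : IsU x) : IsU (-x) := by
  rw [isU_iff, neg_mem_iff]; exact h

theorem IsU.double {x : F.R} (h : IsU x) : IsU (x + x) := by
  have := F.hR.R4 x.pt ((isUnitPt_iff x).2 h)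
  rw [← coe_double_eq] at this
  exact this.1

theorem IsU.add_nonU {x y : F.R} (h : IsU x) (hy : y ∈ nonU F) : IsU (x + y) :=
  fun h' => h ((add_mem_cancel_right hy).1 h')

variable (F) in
/-- The identity of the ring. -/
def one : F.R := R.mk F F.e F.he.2

theorem isU_one : IsU (one F) := F.he.1

/-- A nonunit is a difference of two units. -/
theorem nonU_eq_sub {x : F.R} (hx : x ∈ nonU F) :
    IsU (x + one F) ∧ x = (x + one F) - one F := by
  refine ⟨?_, by abel⟩
  rw [add_comm]; exact isU_one.add_nonU hx

variable (F) in
/-- The points not equivalent to `∞` as elements of `R`, all others going to `0`. -/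
def toR (p : X) : F.R :=
  open Classical in if h : F.M.rel p F.i then 0 else R.mk F p h

theorem coe_toR {p : X} (h : ¬ F.M.rel p F.i) : (toR F p).pt = p := by
  rw [toR, dif_neg h, R.pt_mk]

theorem toR_coe (x : F.R) : toR F x.pt = x := R.ext (coe_toR x.not_rel)

/-! ### Swaps and μ-maps. -/

/-- Elements of the little projective group that interchange `0` and `∞`. -/
structure IsSwap (m : F.Sym) : Prop where
  mem : m ∈ F.M.G
  smul_o : m • F.o = F.i
  smul_i : m • F.i = F.o

theorem IsSwap.inv {m : F.Sym} (h : IsSwap m) : IsSwap m⁻¹ :=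
  ⟨inv_mem h.mem, by rw [← h.smul_i, inv_smul_smul], by rw [← h.smul_o, inv_smul_smul]⟩

theorem IsSwap.rel_i {m : F.Sym} (h : IsSwap m) (p : X) :
    F.M.rel (m • p) F.i ↔ F.M.rel p F.o := by
  conv_lhs => rw [← h.smul_o]
  exact F.rel_smul _ _ _

theorem IsSwap.rel_o {m : F.Sym} (h : IsSwap m) (p : X) :
    F.M.rel (m • p) F.o ↔ F.M.rel p F.i := by
  conv_lhs => rw [← h.smul_i]
  exact F.rel_smul _ _ _

theorem IsSwap.coe_toR {m : F.Sym} (h : IsSwap m) {x : F.R} (hx : IsU x) :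
    (toR F (m • x.pt)).pt = m • x.pt :=
  Frame.coe_toR ((h.rel_i _).not.2 hx)

theorem IsSwap.isU {m : F.Sym} (h : IsSwap m) {x : F.R} (hx : IsU x) :
    IsU (toR F (m • x.pt)) := by
  rw [IsU, h.coe_toR hx, h.rel_o]; exact x.not_rel

/-- The element of `U_0` that maps `∞` to `p`, for a unit `p`. -/
def β (p : F.R) : F.Sym := alphaOf (F.M.U F.o) F.i p.pt

theorem β_mem {p : F.R} (hp : IsU p) : β p ∈ F.M.U F.o := (alphaOf_spec F.hio hp).1

theorem β_smul {p : F.R} (hp : IsU p) : β p • F.i = p.pt := (alphaOf_spec F.hio hp).2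

theorem β_unique {p : F.R} {g : F.Sym} (hg : g ∈ F.M.U F.o) (h : g • F.i = p.pt) : g = β p := by
  have hp : IsU p := by rw [IsU, ← h]; exact (rel_smul_of_mem hg _).not.2 F.hio
  exact root_ext hg (β_mem hp) F.hio (h.trans (β_smul hp).symm)

theorem IsSwap.conj_α {m : F.Sym} (h : IsSwap m) {x : F.R} (hx : IsU x) :
    m * α x * m⁻¹ = β (toR F (m • x.pt)) := by
  refine β_unique ?_ ?_
  · rw [← h.smul_i]; exact conj_mem h.mem (α_mem x)
  · rw [mul_smul, h.inv.smul_i, mul_smul, α_smul, h.coe_toR hx]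

theorem IsSwap.conj_β {m : F.Sym} (h : IsSwap m) {x : F.R} (hx : IsU x) :
    m * β x * m⁻¹ = α (toR F (m • x.pt)) := by
  refine α_unique ?_ ?_
  · rw [← h.smul_o]; exact conj_mem h.mem (β_mem hx)
  · rw [mul_smul, h.inv.smul_o, mul_smul, β_smul hx, h.coe_toR hx]

theorem isMu_isSwap {x : F.R} {m : F.Sym} (h : F.M.IsMu F.o F.i x.pt m) : IsSwap m := by
  obtain ⟨⟨g, hg, k, hk, rfl⟩, h1, h2⟩ := h
  exact ⟨mul_mem (mul_mem (root_le_G _ hk) (root_le_G _ (α_mem x))) (root_le_G _ hg), h1, h2⟩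

theorem exists_isMu {x : F.R} (hx : IsU x) :
    F.M.IsMu F.o F.i x.pt ((β x)⁻¹ * α x * β (-x)) := by
  refine ⟨⟨β (-x), β_mem hx.neg, (β x)⁻¹, inv_mem (β_mem hx), rfl⟩, ?_, ?_⟩
  · rw [mul_smul, F.smul_eq_self (β_mem hx.neg), mul_smul, α_smul, inv_smul_eq_iff, β_smul hx]
  · rw [mul_smul, β_smul hx.neg, mul_smul, ← coe_add, add_neg_cancel, coe_zero]
    exact F.smul_eq_self (inv_mem (β_mem hx))

/-- The map `μ_x`. -/
def μ (x : F.R) : F.Sym := F.M.mu F.o F.i x.pt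

theorem μ_spec {x : F.R} (hx : IsU x) : F.M.IsMu F.o F.i x.pt (μ x) := by
  have h : ∃ m, F.M.IsMu F.o F.i x.pt m := ⟨_, exists_isMu hx⟩
  unfold μ Data.mu
  rw [dif_pos h]
  exact h.choose_spec

theorem μ_isSwap {x : F.R} (hx : IsU x) : IsSwap (μ x) := isMu_isSwap (μ_spec hx)

theorem μ_eq_aux {x : F.R} (hx : IsU x) : μ x = (β x)⁻¹ * α x * β (-x) := by
  obtain ⟨⟨g, hg, k, hk, h⟩, ho, hi⟩ := μ_spec hx
  change μ x = k * α x * g at h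
  rw [h, mul_smul, mul_smul] at ho hi
  have hk' : k⁻¹ = β x := by
    refine β_unique (inv_mem hk) ?_
    rw [← ho, inv_smul_smul, F.smul_eq_self hg, α_smul]
  have hg' : g = β (-x) := by
    refine β_unique hg ?_
    rw [← eq_inv_smul_iff, F.smul_eq_self (inv_mem hk)] at hi
    rw [coe_neg, ← hi, inv_smul_smul]
  rw [h, ← hk', ← hg', inv_inv]

/-- The special condition for an arbitrary unit. -/
theorem β_neg {x : F.R} (hx : IsU x) : β (-x) = (β x)⁻¹ := by
  symm
  have hτ : IsSwap (F.M.mu F.o F.i F.t) :=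
    μ_isSwap (x := R.mk F F.t F.ht.2) F.ht.1
  have h := F.hR.R1 x.pt ((isUnitPt_iff x).2 hx)
  set τ := F.M.mu F.o F.i F.t
  have hy := hτ.inv.conj_β hx
  set y := toR F (τ⁻¹ • x.pt)
  have hyx : y.pt = τ⁻¹ • x.pt := hτ.inv.coe_toR hx
  refine β_unique (inv_mem (β_mem hx)) ?_
  -- Conjugation by `τ` turns `α y` into `β x`, so `∼x = τ (α y)⁻¹ 0` equals `(β x)⁻¹ ∞`, and (R1)
  -- replaces `∼x` by `-x`.
  rw [coe_neg_eq, ← h, Data.tilde, ← hyx, ← coe_neg_eq, coe_neg, ← hy]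
  simp only [mul_inv_rev, inv_inv, mul_smul, hτ.smul_o, smul_inv_smul]

theorem μ_eq {x : F.R} (hx : IsU x) : μ x = (β x)⁻¹ * α x * (β x)⁻¹ := by
  rw [μ_eq_aux hx, β_neg hx]

theorem μ_eq' {x : F.R} (hx : IsU x) : μ x = α x * (β x)⁻¹ * α x := by
  have hm := μ_isSwap hx
  have h := hm.inv.conj_β hx
  rw [inv_inv] at h
  set w := toR F ((μ x)⁻¹ • x.pt)
  -- Formal consequence of `μ_eq` and `α w = (μ x)⁻¹ * β x * μ x`; evaluating at `0` then forces `(α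
  -- w)⁻¹ = α x`.
  have h1 : α x * (β x)⁻¹ * (α w)⁻¹ = μ x := by
    rw [← h, mul_inv_rev, mul_inv_rev, inv_inv, ← mul_assoc, ← mul_assoc]
    conv_rhs => rw [μ_eq hx]
    rw [μ_eq hx]
    group
  have h2 : (α w)⁻¹ = α x := by
    refine α_unique (inv_mem (α_mem w)) ?_
    have h3 := hm.smul_o
    rw [← h1, mul_smul, mul_smul, ← eq_inv_smul_iff, F.smul_eq_self (inv_mem (α_mem x)),
      inv_smul_eq_iff, β_smul hx] at h3
    exact h3
  rw [← h1, h2]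

theorem μ_neg {x : F.R} (hx : IsU x) : μ (-x) = (μ x)⁻¹ := by
  rw [μ_eq hx.neg, β_neg hx, μ_eq hx, α_neg]
  group

theorem IsSwap.toR_neg {m : F.Sym} (h : IsSwap m) {x : F.R} (hx : IsU x) :
    toR F (m • (-x).pt) = - toR F (m • x.pt) := by
  apply R.ext
  rw [h.coe_toR hx.neg, ← β_smul (h.isU hx).neg, β_neg (h.isU hx), ← h.conj_α hx, coe_neg]
  simp only [mul_inv_rev, inv_inv, mul_smul, h.inv.smul_i]

theorem μ_smul_neg_self {x : F.R} (hx : IsU x) : μ x • (-x).pt = x.pt := by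
  rw [μ_eq' hx, mul_smul, ← coe_add, add_neg_cancel, coe_zero, mul_smul,
    F.smul_eq_self (inv_mem (β_mem hx)), α_smul]

theorem μ_smul_self {x : F.R} (hx : IsU x) : μ x • x.pt = (-x).pt := by
  have h := (μ_isSwap hx).toR_neg hx
  rw [μ_smul_neg_self hx, toR_coe] at h
  rw [← (μ_isSwap hx).coe_toR hx, ← neg_eq_iff_eq_neg.2 h]

theorem root_o_neg {z : F.Sym} (hz : z ∈ F.M.U F.o) (hu : ¬ F.M.rel (z • F.i) F.i) :
    toR F (z⁻¹ • F.i) = - toR F (z • F.i) := by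
  have h : z = β (toR F (z • F.i)) := β_unique hz (coe_toR hu).symm
  have hU : IsU (toR F (z • F.i)) := by
    rw [IsU, coe_toR hu]; exact (rel_smul_of_mem hz _).not.2 F.hio
  apply R.ext
  rw [← β_smul hU.neg, β_neg hU, ← h, coe_toR]
  rw [← F.rel_smul z, smul_inv_smul]
  exact fun h' => hu (F.M.rel.symm' h')

/-! ### The fundamental identity and unique 2-divisibility. -/

/-- The fundamental identity `a μ_{a+b} = a μ_b - a - 2b`. -/
theorem μ_add_smul {a b : F.R} (ha : IsU a) (hb : IsU b) (hab : IsU (a + b)) :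
    toR F (μ (a + b) • a.pt) = toR F (μ b • a.pt) - a - (b + b) := by
  -- By `μ_eq'`, `μ b` sends `a` to `b + z ∞`, and `μ (a + b)` sends `-a` to `a + b + z⁻¹ ∞`. As `z`
  -- lies in `U_0`, `root_o_neg` gives `z⁻¹ ∞ = -(z ∞)`, which links the two values.
  set z := (β b)⁻¹ * β (a + b) with hz
  have hzm : z ∈ F.M.U F.o := mul_mem (inv_mem (β_mem hb)) (β_mem hab)
  have hzi : z • F.i = (β b)⁻¹ • (a + b).pt := by rw [hz, mul_smul, β_smul hab]
  have hzu : ¬ F.M.rel (z • F.i) F.i := by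
    rw [hzi, ← F.rel_smul (β b), smul_inv_smul, β_smul hb, rel_coe_iff, add_sub_cancel_right,
      not_not]
    exact ha
  have hzi' : z⁻¹ • F.i = (β (a + b))⁻¹ • b.pt := by
    rw [hz, mul_inv_rev, inv_inv, mul_smul, β_smul hb]
  have hneg := root_o_neg hzm hzu
  have hzu' : ¬ F.M.rel (z⁻¹ • F.i) F.i := by
    rw [← F.rel_smul z, smul_inv_smul]; exact fun h => hzu (F.M.rel.symm' h)
  have h1 : toR F (μ b • a.pt) = b + toR F (z • F.i) := by
    apply R.ext
    rw [(μ_isSwap hb).coe_toR ha, coe_add, coe_toR hzu, hzi, μ_eq' hb, mul_smul, ← coe_add,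
      mul_smul, add_comm]
  have h2 : toR F (μ (a + b) • (-a).pt) = (a + b) + toR F (z⁻¹ • F.i) := by
    apply R.ext
    rw [(μ_isSwap hab).coe_toR ha.neg, coe_add, coe_toR hzu', hzi', μ_eq' hab, mul_smul,
      ← coe_add, mul_smul, show a + b + -a = b by abel]
  rw [(μ_isSwap hab).toR_neg ha, hneg] at h2
  rw [h1, ← neg_inj, h2]
  abel

/-- The fundamental identity at `b = a` gives `μ_{2a}(-a) = 4a`; unfolding `μ_{2a}` by `μ_eq'`, this
says that `β (a + a)` maps `2a` to `a`. Thus doubling the label of `β` takes a square root in `U_0`.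
-/
theorem β_double {a : F.R} (ha : IsU a) : β (a + a) * β (a + a) = β a := by
  have h := μ_add_smul ha ha ha.double
  rw [μ_smul_self ha, toR_coe] at h
  have h1 : toR F (μ (a + a) • (-a).pt) = (a + a) + (a + a) := by
    rw [(μ_isSwap ha.double).toR_neg ha, h]; abel
  have h2 := congrArg R.pt h1
  rw [(μ_isSwap ha.double).coe_toR ha.neg, μ_eq' ha.double, mul_smul, ← coe_add, mul_smul,
    coe_add (a + a) (a + a), smul_left_cancel_iff, add_neg_cancel_right, inv_smul_eq_iff] at h2
  refine β_unique (mul_mem (β_mem ha.double) (β_mem ha.double)) ?_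
  rw [mul_smul, β_smul ha.double, ← h2]

/-- A swap conjugates `α` into `β`, where doubling the label is halving. -/
theorem IsSwap.double {m : F.Sym} (h : IsSwap m) {a : F.R} (ha : IsU a) :
    toR F (m • (a + a).pt) + toR F (m • (a + a).pt) = toR F (m • a.pt) := by
  apply α_injective
  rw [α_add, ← h.conj_β ha, ← h.conj_β ha.double, ← β_double ha]
  group

/-- Such an `x` is a nonunit by (R4), so `x + e` is a unit with the same double as `e`. By
`IsSwap.double` the double of a unit determines its image under a swap, hence the unit itself. -/
theorem double_eq_zero {x : F.R} (h : x + x = 0) : x = 0 := by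
  have hx : x ∈ nonU F := by
    rw [mem_nonU]
    intro hU
    apply hU.double
    rw [h, coe_zero]
  have hm := μ_isSwap (isU_one (F := F))
  have hU := (nonU_eq_sub hx).1
  have h1 := hm.double hU
  rw [show x + one F + (x + one F) = one F + one F + (x + x) by abel, h, add_zero,
    hm.double isU_one] at h1
  have h2 := congrArg R.pt h1
  rw [hm.coe_toR isU_one, hm.coe_toR hU, smul_left_cancel_iff] at h2
  simpa using (R.ext h2).symm

theorem double_injective {x y : F.R} (h : x + x = y + y) : x = y := by
  rw [← sub_eq_zero]
  apply double_eq_zero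
  rw [show x - y + (x - y) = (x + x) - (y + y) by abel, h, sub_self]

theorem exists_double (x : F.R) : ∃ y : F.R, y + y = x := by
  have key : ∀ x : F.R, IsU x → ∃ y : F.R, y + y = x := by
    intro x hx
    have hm := μ_isSwap (isU_one (F := F))
    -- To halve `x`, apply the swap, double, and apply the inverse swap.
    refine ⟨_, ((hm.inv).double (hm.isU hx)).trans ?_⟩
    rw [hm.coe_toR hx, inv_smul_smul, toR_coe]
  by_cases hx : IsU x
  · exact key x hx
  · obtain ⟨h1, h2⟩ := nonU_eq_sub ((mem_nonU x).2 hx)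
    obtain ⟨y, hy⟩ := key _ h1
    obtain ⟨z, hz⟩ := key _ isU_one
    exact ⟨y - z, by rw [h2, ← hy, ← hz]; abel⟩

/-! ### Torus elements, and the μ-maps as involutions. -/

/-- Elements of the little projective group that fix `0` and `∞`. -/
structure IsTorus (h : F.Sym) : Prop where
  mem : h ∈ F.M.G
  smul_o : h • F.o = F.o
  smul_i : h • F.i = F.i

theorem IsSwap.mul {m n : F.Sym} (hm : IsSwap m) (hn : IsSwap n) : IsTorus (m * n) :=
  ⟨mul_mem hm.mem hn.mem, by rw [mul_smul, hn.smul_o, hm.smul_i],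
    by rw [mul_smul, hn.smul_i, hm.smul_o]⟩

theorem IsTorus.rel_i {h : F.Sym} (hh : IsTorus h) (p : X) :
    F.M.rel (h • p) F.i ↔ F.M.rel p F.i := by
  conv_lhs => rw [← hh.smul_i]
  exact F.rel_smul _ _ _

theorem IsTorus.rel_o {h : F.Sym} (hh : IsTorus h) (p : X) :
    F.M.rel (h • p) F.o ↔ F.M.rel p F.o := by
  conv_lhs => rw [← hh.smul_o]
  exact F.rel_smul _ _ _

theorem IsTorus.coe_toR {h : F.Sym} (hh : IsTorus h) (x : F.R) :
    (toR F (h • x.pt)).pt = h • x.pt :=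
  Frame.coe_toR ((hh.rel_i _).not.2 x.not_rel)

theorem IsTorus.conj_α {h : F.Sym} (hh : IsTorus h) (x : F.R) :
    h * α x * h⁻¹ = α (toR F (h • x.pt)) := by
  refine α_unique ?_ ?_
  · have := conj_mem hh.mem (α_mem x)
    rwa [hh.smul_i] at this
  · rw [mul_smul, inv_smul_eq_iff.2 hh.smul_o.symm, mul_smul, α_smul, hh.coe_toR]

/-- The endomorphism of the group `R` induced by an element that fixes `0` and `∞`. -/
def IsTorus.toEnd {h : F.Sym} (hh : IsTorus h) : AddMonoid.End F.R :=
  AddMonoidHom.mk' (fun x => toR F (h • x.pt)) fun x y => by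
    apply α_injective
    rw [α_add, ← hh.conj_α, ← hh.conj_α, ← hh.conj_α, α_add]
    group

theorem IsTorus.coe_toEnd {h : F.Sym} (hh : IsTorus h) (x : F.R) :
    (hh.toEnd x).pt = h • x.pt := hh.coe_toR x

theorem μ_mul_μ_mem {x y : F.R} (hx : IsU x) (hy : IsU y) :
    μ y * μ x ∈ F.M.huaSubgroup F.o F.i :=
  Subgroup.subset_closure ⟨x.pt, y.pt, (isUnitPt_iff x).2 hx, (isUnitPt_iff y).2 hy, rfl⟩

/-- The square `z = μ b * μ b` fixes `b` and, by (R3), commutes with `μ d * μ b`, so it fixes every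
`μ_d(b)`. In the fundamental identity for `μ_{b+d}(b)` all terms other than `2d` are then known to
be fixed, so `d` is fixed as well. -/
theorem μ_mul_μ_smul {b c : F.R} (hb : IsU b) (hc : IsU c) : (μ b * μ b) • c.pt = c.pt := by
  have hz : IsTorus (μ b * μ b) := (μ_isSwap hb).mul (μ_isSwap hb)
  have hfix : ∀ d : F.R, IsU d →
      hz.toEnd (toR F (μ d • b.pt)) = toR F (μ d • b.pt) := by
    intro d hd
    have hd' := μ_isSwap hd
    have h1 : (μ d * μ b) • b.pt = (- toR F (μ d • b.pt)).pt := by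
      rw [mul_smul, μ_smul_self hb, ← hd'.toR_neg hb, hd'.coe_toR hb.neg]
    have h2 : hz.toEnd (- toR F (μ d • b.pt)) = - toR F (μ d • b.pt) := by
      apply R.ext
      rw [hz.coe_toEnd, ← h1, ← mul_smul,
        F.hR.R3 _ (μ_mul_μ_mem hb hb) _ (μ_mul_μ_mem hb hd), mul_smul (μ d * μ b),
        mul_smul (μ b), μ_smul_self hb, μ_smul_neg_self hb]
    rwa [map_neg, neg_inj] at h2
  have hb' : hz.toEnd b = b := by
    apply R.ext
    rw [hz.coe_toEnd, mul_smul, μ_smul_self hb, μ_smul_neg_self hb]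
  have key : ∀ d : F.R, IsU d → IsU (b + d) → hz.toEnd d = d := by
    intro d hd hbd
    have h := hfix _ hbd
    rw [μ_add_smul hb hd hbd, map_sub, map_sub, hfix d hd, hb', map_add, sub_right_inj] at h
    exact double_injective h
  have hc' : hz.toEnd c = c := by
    by_cases h : IsU (b + c)
    · exact key c hc h
    · have h' : IsU (b + -c) := by
        have := hb.double.add_nonU (neg_mem ((mem_nonU _).2 h))
        rwa [show b + b + -(b + c) = b + -c by abel] at this
      have := key _ hc.neg h'
      rwa [map_neg, neg_inj] at this
  rw [← hz.coe_toEnd, hc']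

theorem μ_mul_self {b : F.R} (hb : IsU b) : μ b * μ b = 1 := by
  have hm := μ_isSwap hb
  have hz : IsTorus (μ b * μ b) := hm.mul hm
  have key : ∀ x : F.R, (μ b * μ b) • x.pt = x.pt := by
    intro x
    by_cases hx : IsU x
    · exact μ_mul_μ_smul hb hx
    · obtain ⟨h1, h2⟩ := nonU_eq_sub ((mem_nonU x).2 hx)
      have e1 : hz.toEnd (x + one F) = x + one F :=
        R.ext ((hz.coe_toEnd _).trans (μ_mul_μ_smul hb h1))
      have e2 : hz.toEnd (one F) = one F :=
        R.ext ((hz.coe_toEnd _).trans (μ_mul_μ_smul hb isU_one))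
      have e3 : hz.toEnd x = x := by rw [h2, map_sub, e1, e2]
      rw [← hz.coe_toEnd, e3]
  have key' : ∀ p : X, (μ b * μ b) • p = p := by
    intro p
    -- Points in the class of `∞` are moved into `R` by `μ b`, which commutes with its own square.
    by_cases hp : F.M.rel p F.i
    · have hq : ¬ F.M.rel (μ b • p) F.i := by
        rw [hm.rel_i]
        exact fun h => F.hoi (F.M.rel.trans' (F.M.rel.symm' h) hp)
      have := key (R.mk F _ hq)
      rw [R.pt_mk, ← mul_smul, mul_assoc, mul_smul, smul_left_cancel_iff] at this
      exact this
    · exact key (R.mk F p hp)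
  apply Subtype.ext
  ext p
  exact key' p

theorem μ_smul_μ_smul {b : F.R} (hb : IsU b) (p : X) : μ b • μ b • p = p := by
  rw [← mul_smul, μ_mul_self hb, one_smul]

theorem μ_neg_eq {b : F.R} (hb : IsU b) : μ (-b) = μ b := by
  rw [μ_neg hb, inv_eq_iff_mul_eq_one, μ_mul_self hb]

theorem isTorus_hua {y : F.R} (hy : IsU y) : IsTorus (μ y * μ (one F)) :=
  (μ_isSwap hy).mul (μ_isSwap isU_one)

/-! ### Hua maps and the endomorphisms `R_y`. -/

open Classical in
/-- The Hua map `h_y` as an endomorphism of the group `R`, for a unit `y`. -/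
def huaEnd (y : F.R) : AddMonoid.End F.R :=
  -- The value `0` at nonunits lets commutation and stability of `nonU` hold for every `y`.
  if hy : IsU y then (isTorus_hua hy).toEnd else 0

theorem coe_huaEnd {y : F.R} (hy : IsU y) (x : F.R) :
    (huaEnd y x).pt = μ y • μ (one F) • x.pt := by
  rw [huaEnd, dif_pos hy, IsTorus.coe_toEnd, mul_smul]

theorem huaEnd_commute (y z : F.R) : Commute (huaEnd y) (huaEnd z) := by
  by_cases hy : IsU y
  · by_cases hz : IsU z
    · ext x
      apply R.ext
      have := F.hR.R3 _ (μ_mul_μ_mem isU_one hy) _ (μ_mul_μ_mem isU_one hz)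
      change (huaEnd y (huaEnd z x)).pt = (huaEnd z (huaEnd y x)).pt
      rw [coe_huaEnd hy, coe_huaEnd hz, coe_huaEnd hz, coe_huaEnd hy]
      simp only [← mul_smul]
      rw [← mul_assoc (μ y), this, mul_assoc (μ z)]
    · rw [huaEnd, huaEnd, dif_neg hz]; exact Commute.zero_right _
  · rw [huaEnd, dif_neg hy]; exact Commute.zero_left _

theorem huaEnd_mem_nonU (y : F.R) {x : F.R} (hx : x ∈ nonU F) : huaEnd y x ∈ nonU F := by
  by_cases hy : IsU y
  · change F.M.rel _ _
    rw [coe_huaEnd hy, ← mul_smul, (isTorus_hua hy).rel_o]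
    exact hx
  · rw [huaEnd, dif_neg hy]; exact zero_mem _

theorem huaEnd_one_right {y : F.R} (hy : IsU y) :
    huaEnd y (one F) = - toR F (μ y • (one F).pt) := by
  rw [← (μ_isSwap hy).toR_neg isU_one]
  apply R.ext
  rw [coe_huaEnd hy, μ_smul_self isU_one, (μ_isSwap hy).coe_toR isU_one.neg]

theorem huaEnd_one_left : huaEnd (one F) = 1 := by
  ext x
  apply R.ext
  rw [coe_huaEnd isU_one, μ_smul_μ_smul isU_one]
  rfl

theorem huaEnd_neg {y : F.R} (hy : IsU y) : huaEnd (-y) = huaEnd y := by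
  ext x
  apply R.ext
  rw [coe_huaEnd hy, coe_huaEnd hy.neg, μ_neg_eq hy]

theorem huaEnd_one_add {y : F.R} (hy : IsU y) (hy' : IsU (one F + y)) :
    huaEnd (one F + y) (one F) = huaEnd y (one F) + one F + (y + y) := by
  rw [huaEnd_one_right hy, huaEnd_one_right hy', μ_add_smul isU_one hy hy']
  abel

theorem huaEnd_neg_one_add {y : F.R} (hy : IsU y) (hy' : IsU (-one F + y)) :
    huaEnd (-one F + y) (one F) = huaEnd y (one F) + one F - (y + y) := by
  have h := huaEnd_one_add hy.neg (by
    have := hy'.neg; rwa [neg_add, neg_neg] at this)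
  rw [huaEnd_neg hy, show one F + -y = -(-one F + y) by abel, huaEnd_neg hy'] at h
  rw [h]; abel

open Classical in
/-- The map `R_y`, as an endomorphism of the group `R`. -/
def mulEnd (y : F.R) : AddMonoid.End F.R :=
  if IsU y then
    if IsU (y + one F) then huaEnd (one F + y) - huaEnd y - 1
    else -huaEnd (-one F + y) + 1 + huaEnd y
  else
    huaEnd (one F + one F + y) - huaEnd (one F + y) - huaEnd (-(one F + one F)) + 1

theorem isU_neg_one_add {y : F.R} (h : ¬ IsU (y + one F)) : IsU (-one F + y) := by
  have := isU_one.double.neg.add_nonU ((mem_nonU _).2 h)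
  rwa [show -(one F + one F) + (y + one F) = -one F + y by abel] at this

theorem isU_one_add {y : F.R} (h : ¬ IsU y) : IsU (one F + y) :=
  isU_one.add_nonU ((mem_nonU _).2 h)

theorem isU_two_add {y : F.R} (h : ¬ IsU y) : IsU (one F + one F + y) :=
  isU_one.double.add_nonU ((mem_nonU _).2 h)

theorem coe_mulEnd (y x : F.R) : (mulEnd y x).pt = F.M.Rmap F.o F.i F.e y.pt x.pt := by
  have hua : ∀ z : F.R, IsU z →
      F.M.hua F.o F.i (F.M.mu F.o F.i F.e) z.pt • x.pt = (huaEnd z x).pt := by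
    intro z hz
    rw [coe_huaEnd hz, ← mul_smul]; rfl
  have he : F.e = (one F).pt := rfl
  rw [he] at hua ⊢
  have hy := isUnitPt_iff y
  have hy' := isUnitPt_iff (y + one F)
  rw [coe_add_eq] at hy'
  unfold Data.Rmap mulEnd
  by_cases h1 : IsU y
  · by_cases h2 : IsU (y + one F)
    · simp only [if_pos h1, if_pos h2, if_pos (hy.2 h1), if_pos (hy'.2 h2), ← coe_add_eq]
      rw [hua _ h1, hua _ (by rwa [add_comm]), ← coe_sub_eq, ← coe_sub_eq]
      rfl
    · simp only [if_pos h1, if_neg h2, if_pos (hy.2 h1), if_neg (hy'.not.2 h2), ← coe_neg_eq,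
        ← coe_add_eq]
      rw [hua _ h1, hua _ (isU_neg_one_add h2), ← coe_neg_eq, ← coe_add_eq, ← coe_add_eq]
      rfl
  · simp only [if_neg h1, if_neg (hy.not.2 h1), ← coe_double_eq, ← coe_neg_eq, ← coe_add_eq]
    rw [hua _ (isU_two_add h1), hua _ (isU_one_add h1), hua _ isU_one.double.neg,
      ← coe_sub_eq, ← coe_sub_eq, ← coe_add_eq]
    rfl

theorem commute_mulEnd {f : AddMonoid.End F.R} (hf : ∀ y : F.R, Commute f (huaEnd y))
    (y : F.R) : Commute f (mulEnd y) := by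
  have h1 := Commute.one_right f
  unfold mulEnd
  split_ifs
  · exact ((hf _).sub_right (hf _)).sub_right h1
  · exact ((hf _).neg_right.add_right h1).add_right (hf _)
  · exact (((hf _).sub_right (hf _)).sub_right (hf _)).add_right h1

theorem huaEnd_commute_mulEnd (y z : F.R) : Commute (huaEnd y) (mulEnd z) :=
  commute_mulEnd (huaEnd_commute y) z

theorem mulEnd_commute (y z : F.R) : Commute (mulEnd y) (mulEnd z) :=
  commute_mulEnd (fun w => (huaEnd_commute_mulEnd w y).symm) z

/-- This is where the three cases of `R_y` agree: the fundamental identity at `a = e` gives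
`h_{e+y}(e) = h_y(e) + e + 2y`, and the remaining terms of each case cancel all but `2y`. -/
theorem mulEnd_one (y : F.R) : mulEnd y (one F) = y + y := by
  unfold mulEnd
  split_ifs with h1 h2
  · change huaEnd (one F + y) (one F) - huaEnd y (one F) - one F = _
    rw [huaEnd_one_add h1 (by rwa [add_comm])]; abel
  · change -huaEnd (-one F + y) (one F) + one F + huaEnd y (one F) = _
    rw [huaEnd_neg_one_add h1 (isU_neg_one_add h2)]; abel
  · change huaEnd (one F + one F + y) (one F) - huaEnd (one F + y) (one F)
      - huaEnd (-(one F + one F)) (one F) + one F = _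
    have h := isU_two_add h1
    rw [add_assoc] at h ⊢
    rw [huaEnd_one_add (isU_one_add h1) h, huaEnd_neg isU_one.double,
      huaEnd_one_add isU_one isU_one.double, huaEnd_one_left]
    change _ - (one F + one F + (one F + one F)) + one F = y + y
    abel

theorem mulEnd_mem_nonU (y : F.R) {x : F.R} (hx : x ∈ nonU F) : mulEnd y x ∈ nonU F := by
  unfold mulEnd
  split_ifs
  · exact sub_mem (sub_mem (huaEnd_mem_nonU _ hx) (huaEnd_mem_nonU _ hx)) hx
  · exact add_mem (add_mem (neg_mem (huaEnd_mem_nonU _ hx)) hx) (huaEnd_mem_nonU _ hx)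
  · exact add_mem (sub_mem (sub_mem (huaEnd_mem_nonU _ hx) (huaEnd_mem_nonU _ hx))
      (huaEnd_mem_nonU _ hx)) hx

/-- Evaluate `R_x R_y = R_y R_x` at `e`. Additivity of `R_y` in the index `y` comes only from this
symmetry. -/
theorem mulEnd_comm (x y : F.R) : mulEnd x y = mulEnd y x := by
  apply double_injective
  rw [← map_add, ← map_add, ← mulEnd_one y, ← mulEnd_one x]
  exact DFunLike.congr_fun (mulEnd_commute x y) (one F)

/-! ### The commutative ring structure. -/

instance : Mul F.R := ⟨fun x y => (exists_double (mulEnd y x)).choose⟩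

theorem double_mul (x y : F.R) : x * y + x * y = mulEnd y x :=
  (exists_double (mulEnd y x)).choose_spec

instance : One F.R := ⟨one F⟩

theorem one_def : (1 : F.R) = one F := rfl

theorem mul_comm_aux (x y : F.R) : x * y = y * x :=
  double_injective (by rw [double_mul, double_mul, mulEnd_comm])

theorem add_mul_aux (x y z : F.R) : (x + y) * z = x * z + y * z := by
  apply double_injective
  rw [double_mul, map_add, ← double_mul, ← double_mul]
  abel

theorem one_mul_aux (x : F.R) : 1 * x = x :=
  double_injective (by rw [double_mul, one_def, mulEnd_one])

/-- After clearing the factors 1/2, this is the commutation of `R_z` and `R_x` evaluated at `y`. -/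
theorem mul_assoc_aux (x y z : F.R) : x * y * z = x * (y * z) := by
  rw [mul_comm_aux x (y * z)]
  apply double_injective
  rw [double_mul, double_mul]
  apply double_injective
  rw [← map_add, ← map_add, double_mul, double_mul, mulEnd_comm y x]
  exact DFunLike.congr_fun (mulEnd_commute z x) y

instance : CommRing F.R :=
  { (inferInstance : AddCommGroup F.R), (inferInstance : Mul F.R), (inferInstance : One F.R) with
    mul_comm := mul_comm_aux
    mul_assoc := mul_assoc_aux
    one_mul := one_mul_aux
    mul_one := fun x => by rw [mul_comm_aux, one_mul_aux]
    right_distrib := add_mul_aux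
    left_distrib := fun x y z => by
      rw [mul_comm_aux, add_mul_aux, mul_comm_aux y, mul_comm_aux z]
    zero_mul := fun x => double_injective (by rw [double_mul, map_zero, add_zero])
    mul_zero := fun x => by
      rw [mul_comm_aux]
      exact double_injective (by rw [double_mul, map_zero, add_zero]) }

theorem mulEnd_eq (x y : F.R) : mulEnd y x = 2 * (x * y) := by
  rw [← double_mul, two_mul]

theorem coe_mul_eq (x y : F.R) : (x * y).pt = F.M.mul F.o F.i F.e x.pt y.pt := by
  have h : ∃ z, ¬ F.M.rel z F.i ∧
      F.M.times F.o F.i z 2 = F.M.Rmap F.o F.i F.e y.pt x.pt :=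
    ⟨(x * y).pt, (x * y).not_rel, by rw [← coe_double_eq, double_mul, coe_mulEnd]⟩
  rw [Data.mul, Data.half, dif_pos h]
  have hz := h.choose_spec
  have : x * y = R.mk F _ hz.1 := by
    apply double_injective
    rw [double_mul]
    apply R.ext
    rw [coe_mulEnd, coe_double_eq, R.pt_mk, hz.2]
  exact congrArg R.pt this

/-- An endomorphism commuting with all `R_x` is multiplication by its value at `e`. -/
theorem huaEnd_eq (y x : F.R) : huaEnd y x = huaEnd y 1 * x := by
  apply double_injective
  rw [double_mul, ← map_add, ← mulEnd_one]
  exact DFunLike.congr_fun (huaEnd_commute_mulEnd y x) (one F)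

/-! ### Inverses and locality. -/

/-- The map `μ_e` is `x ↦ -x⁻¹` on units. -/
theorem mul_μ_one {a : F.R} (ha : IsU a) : a * toR F (μ (1 : F.R) • a.pt) = -1 := by
  have hm := μ_isSwap (isU_one (F := F))
  change a * toR F (μ (one F) • a.pt) = -1
  set a' := toR F (μ (one F) • a.pt)
  have ha' : a'.pt = μ (one F) • a.pt := hm.coe_toR ha
  have hq : ∀ b : F.R, IsU b → huaEnd b 1 * a' = toR F (μ b • a.pt) := by
    intro b hb
    rw [← huaEnd_eq]
    apply R.ext
    rw [coe_huaEnd hb, ha', μ_smul_μ_smul isU_one, (μ_isSwap hb).coe_toR ha]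
  have h0 : huaEnd a 1 * a' = -a := by
    rw [hq a ha, μ_smul_self ha, toR_coe]
  -- Multiplying the value of `h_{b+a}(1)` by `a'` turns the fundamental identity into `2aba' =
  -- -2b`. It is used for `b = 1` or `b = -1`, whichever makes `b + a` a unit.
  have key : ∀ b : F.R, IsU b → huaEnd b = 1 → IsU (b + a) →
      huaEnd (b + a) 1 = huaEnd a 1 + 1 + 2 * a * b → a * b * a' = -b := by
    intro b hb hb1 hba h
    have h1 := μ_add_smul ha hb (by rwa [add_comm])
    rw [add_comm, ← hq _ hba, ← hq _ hb, h, hb1] at h1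
    have h2 : (1 : AddMonoid.End F.R) 1 = 1 := rfl
    rw [h2] at h1
    apply double_injective
    linear_combination h1 - h0
  by_cases h : IsU (a + one F)
  · have h' : IsU (one F + a) := by rwa [add_comm]
    have := key (one F) isU_one huaEnd_one_left h' (by
      rw [one_def, huaEnd_one_add ha h', ← one_def]; ring)
    rwa [← one_def, mul_one] at this
  · have h' := isU_neg_one_add h
    have := key (-one F) isU_one.neg (by rw [huaEnd_neg isU_one, huaEnd_one_left]) h' (by
      rw [one_def, huaEnd_neg_one_add ha h', ← one_def]; ring)
    rw [← one_def] at this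
    linear_combination -this

theorem IsU.isUnit {a : F.R} (ha : IsU a) : IsUnit a :=
  IsUnit.of_mul_eq_one (- toR F (μ (1 : F.R) • a.pt)) (by rw [mul_neg, mul_μ_one ha, neg_neg])

/-- `R_b` preserves the class of `0`, and by (R4) halving cannot lead out of it. -/
theorem mul_mem_nonU {a : F.R} (ha : a ∈ nonU F) (b : F.R) : a * b ∈ nonU F := by
  rw [mem_nonU]
  intro h
  apply h.double
  rw [double_mul]
  exact mulEnd_mem_nonU b ha

theorem isUnit_iff {a : F.R} : IsUnit a ↔ IsU a := by
  refine ⟨fun h ha => ?_, IsU.isUnit⟩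
  obtain ⟨b, hb⟩ := h.exists_right_inv
  have := mul_mem_nonU (F := F) ha b
  rw [hb] at this
  exact isU_one this

instance : IsLocalRing F.R :=
  haveI : Nontrivial F.R :=
    ⟨1, 0, fun h => isU_one (F := F) (by
      rw [← one_def, h, coe_zero])⟩
  IsLocalRing.of_isUnit_or_isUnit_one_sub_self fun a => by
    by_cases ha : IsU a
    · exact Or.inl ha.isUnit
    · right
      rw [sub_eq_add_neg]
      exact (isU_one.add_nonU (neg_mem ((mem_nonU a).2 ha))).isUnit

theorem mem_maximalIdeal_iff {a : F.R} :
    a ∈ IsLocalRing.maximalIdeal F.R ↔ F.M.rel a.pt F.o := by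
  rw [IsLocalRing.mem_maximalIdeal, mem_nonunits_iff, isUnit_iff, IsU, not_not]

end Frame

end

/-! Transport of local Moufang sets along bijections. -/

section Transport

variable {X Y : Type u}

/-- The isomorphism of symmetry groups induced by a bijection that preserves the relations. -/
def symEquiv {r : Setoid X} {s : Setoid Y} (φ : X ≃ Y)
    (h : ∀ x x', r x x' ↔ s (φ x) (φ x')) : SymRel r ≃* SymRel s where
  toFun g := ⟨(φ.symm.trans g.1).trans φ, fun x y => by
    have := (h (φ.symm x) (φ.symm y)).symm.trans (g.2 (φ.symm x) (φ.symm y))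
    rw [φ.apply_symm_apply, φ.apply_symm_apply] at this
    exact this.trans (h _ _)⟩
  invFun g := ⟨(φ.trans g.1).trans φ.symm, fun x y => by
    have := (h x y).trans (g.2 (φ x) (φ y))
    refine this.trans ?_
    rw [h]
    simp⟩
  left_inv g := by ext x; simp
  right_inv g := by ext x; simp
  map_mul' g g' := by ext x; simp

theorem symEquiv_smul {r : Setoid X} {s : Setoid Y} (φ : X ≃ Y)
    (h : ∀ x x', r x x' ↔ s (φ x) (φ x')) (g : SymRel r) (x : X) :
    symEquiv φ h g • φ x = φ (g • x) := by
  change φ (g.1 (φ.symm (φ x))) = φ (g.1 x)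
  rw [φ.symm_apply_apply]

theorem SharplyTransitiveOn.transport {G G' : Type u} [Group G] [Group G'] [MulAction G X]
    [MulAction G' Y] {H : Subgroup G} {S : Set X} (hS : SharplyTransitiveOn H S) (Ψ : G ≃* G')
    (f : X ≃ Y) (hf : ∀ g x, Ψ g • f x = f (g • x)) {S' : Set Y}
    (hS' : ∀ x, f x ∈ S' → x ∈ S) :
    SharplyTransitiveOn (H.map Ψ.toMonoidHom) S' := by
  intro y hy z hz
  obtain ⟨y, rfl⟩ := f.surjective y
  obtain ⟨z, rfl⟩ := f.surjective z
  obtain ⟨g, ⟨hg, hgy⟩, hu⟩ := hS y (hS' y hy) z (hS' z hz)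
  refine ⟨Ψ g, ⟨⟨g, hg, rfl⟩, by rw [hf, hgy]⟩, ?_⟩
  rintro _ ⟨⟨k, hk, rfl⟩, hky⟩
  change Ψ k • f y = f z at hky
  rw [hf] at hky
  exact congrArg Ψ (hu k ⟨hk, f.injective hky⟩)

theorem conjBy_map {G G' : Type u} [Group G] [Group G'] (Ψ : G ≃* G') (H : Subgroup G) (g : G) :
    conjBy (H.map Ψ.toMonoidHom) (Ψ g) = (conjBy H g).map Ψ.toMonoidHom := by
  unfold conjBy
  rw [Subgroup.map_map, Subgroup.map_map]
  congr 1
  ext x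
  simp

/-- The little projective group and the groups induced on classes are also images of those of `M`,
the latter by conjugation with the bijection `Q` of classes; each axiom is then pulled back. -/
theorem Data.IsLocalMoufangSet.transport {M : Data X} {N : Data Y} (hM : M.IsLocalMoufangSet)
    (φ : X ≃ Y) (h : ∀ x x', M.rel x x' ↔ N.rel (φ x) (φ x'))
    (hU : ∀ x, N.U (φ x) = (M.U x).map (symEquiv φ h).toMonoidHom) :
    N.IsLocalMoufangSet := by
  let Q : Quotient M.rel ≃ Quotient N.rel := Quotient.congr φ h
  have hQ : ∀ x, Q (Quotient.mk _ x) = Quotient.mk _ (φ x) := fun x => rfl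
  have hbar : ∀ x, N.Ubar (φ x) = (M.Ubar x).map Q.permCongrHom.toMonoidHom := by
    intro x
    unfold Data.Ubar
    rw [hU, Subgroup.map_map, Subgroup.map_map]
    congr 1
    ext g q
    obtain ⟨q, rfl⟩ := Q.surjective q
    induction q using Quotient.inductionOn with
    | h x =>
      change Quotient.mk N.rel (symEquiv φ h g • φ x) = Q (induced M.rel g (Q.symm (Q (Quotient.mk M.rel x))))
      rw [Q.symm_apply_apply, symEquiv_smul]
      rfl
  have hG : N.G = M.G.map (symEquiv φ h).toMonoidHom := by
    unfold Data.G
    rw [Subgroup.map_iSup, ← φ.surjective.iSup_comp]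
    simp only [hU]
  refine ⟨?_, ?_, ?_, ?_, ?_, ?_, ?_⟩
  · rw [← Cardinal.mk_congr Q]; exact hM.two_lt_card
  · intro x y hxy
    obtain ⟨x, rfl⟩ := φ.surjective x
    obtain ⟨y, rfl⟩ := φ.surjective y
    rw [hbar, hbar, hM.LM0 x y ((h x y).2 hxy)]
  · intro x g hg
    obtain ⟨x, rfl⟩ := φ.surjective x
    rw [hU] at hg
    obtain ⟨k, hk, rfl⟩ := hg
    exact (symEquiv_smul φ h k x).trans (congrArg φ (hM.LM1_fix x k hk))
  · intro x
    obtain ⟨x, rfl⟩ := φ.surjective x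
    rw [hU]
    exact (hM.LM1 x).transport (symEquiv φ h) φ (symEquiv_smul φ h)
      fun y hy hyx => hy ((h y x).1 hyx)
  · intro x g hg
    obtain ⟨x, rfl⟩ := φ.surjective x
    rw [hbar] at hg
    obtain ⟨k, hk, rfl⟩ := hg
    change Q (k (Q.symm (Q (Quotient.mk _ x)))) = Q (Quotient.mk _ x)
    rw [Q.symm_apply_apply]
    exact congrArg Q (hM.LM1'_fix x k hk)
  · intro x
    obtain ⟨x, rfl⟩ := φ.surjective x
    rw [hbar]
    refine (hM.LM1' x).transport Q.permCongrHom Q (fun g q => ?_)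
      fun q hq hqx => hq ((congrArg Q hqx).trans (hQ x))
    change Q (g (Q.symm (Q q))) = Q (g q)
    rw [Q.symm_apply_apply]
  · intro x g hg
    obtain ⟨x, rfl⟩ := φ.surjective x
    rw [hG] at hg
    obtain ⟨k, hk, rfl⟩ := hg
    change conjBy _ (symEquiv φ h k) = N.U (symEquiv φ h k • φ x)
    rw [symEquiv_smul, hU, hU, conjBy_map, hM.LM2 x k hk]

end Transport

/-! The projective line. -/

section Projective

variable {R : Type u} [CommRing R]

theorem P1.mk_eq_iff {a b c d : R} (h : IsCoprime a b) (h' : IsCoprime c d) :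
    P1.mk a b h = P1.mk c d h' ↔ ∃ u : Rˣ, c = u * a ∧ d = u * b := by
  refine Quotient.eq.trans (exists_congr fun u => ?_)
  change ![c, d] = (u : R) • ![a, b] ↔ _
  rw [funext_iff, Fin.forall_fin_two]
  simp

theorem P1.exists_mk (p : P1 R) : ∃ a b h, p = P1.mk a b h := by
  induction p using Quotient.inductionOn with
  | h v =>
    refine ⟨v.1 0, v.1 1, v.2, ?_⟩
    unfold P1.mk
    congr 1
    apply Subtype.ext
    ext j
    fin_cases j <;> rfl

theorem slMap_upperMatrix {a b : R} (h : IsCoprime a b) (r : R) {h'} :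
    slMap (upperMatrix r) (P1.mk a b h) = P1.mk a (a * r + b) h' := by
  apply Quotient.sound
  refine ⟨1, ?_⟩
  ext j
  fin_cases j <;> simp [upperMatrix]

theorem slMap_tauMatrix {a b : R} (h : IsCoprime a b) {h'} :
    slMap (tauMatrix R) (P1.mk a b h) = P1.mk b (-a) h' := by
  apply Quotient.sound
  refine ⟨1, ?_⟩
  ext j
  fin_cases j <;> simp [tauMatrix]

theorem P1.rel_mk [IsLocalRing R] {a b c d : R} (h : IsCoprime a b) (h' : IsCoprime c d) :
    P1.rel R (P1.mk a b h) (P1.mk c d h') ↔ a * d - b * c ∈ IsLocalRing.maximalIdeal R :=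
  Iff.rfl

end Projective

/-! ### The bijection from `X` to `ℙ¹(R)`. -/

namespace Frame

variable {X : Type u} {F : Frame X}

variable (F) in
/-- The involution `μ_e`. -/
def τ : F.Sym := μ (one F)

theorem τ_isSwap : IsSwap (τ F) := μ_isSwap isU_one

theorem τ_smul_τ_smul (p : X) : τ F • τ F • p = p := μ_smul_μ_smul isU_one p

theorem mul_τ {a : F.R} (ha : IsU a) : a * toR F (τ F • a.pt) = -1 := mul_μ_one ha

theorem exists_eq_pt (p : X) :
    (∃ x : F.R, p = x.pt) ∨ ∃ x : F.R, x ∈ nonU F ∧ p = τ F • x.pt := by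
  by_cases hp : F.M.rel p F.i
  · have hq : F.M.rel (τ F • p) F.o := (τ_isSwap.rel_o p).2 hp
    have hq' : ¬ F.M.rel (τ F • p) F.i := fun h =>
      F.hoi (F.M.rel.trans' (F.M.rel.symm' hq) h)
    exact Or.inr ⟨R.mk F _ hq', hq, (τ_smul_τ_smul p).symm⟩
  · exact Or.inl ⟨R.mk F p hp, rfl⟩

theorem τ_smul_rel_i {x : F.R} (hx : x ∈ nonU F) : F.M.rel (τ F • x.pt) F.i :=
  (τ_isSwap.rel_i _).2 hx

/-- The explicit form of the action of `U_∞` on the class of `∞`. -/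
theorem star_eq (hstar : F.M.StarIdentity F.o F.i F.e) {x : F.R} (hx : x ∈ nonU F) (y : F.R) :
    ∃ u ∈ nonU F, (1 - x * y) * u = x ∧ α y • τ F • x.pt = τ F • u.pt := by
  have h := hstar x.pt y.pt hx y.not_rel
  have he : F.e = (one F).pt := rfl
  rw [← coe_mulEnd, he, ← coe_double_eq, ← coe_neg_eq] at h
  change α y • τ F • x.pt = τ F • F.M.Rmap F.o F.i F.e x.pt
    (τ F • α (-(one F + one F)) • (mulEnd x y).pt) at h
  rw [← coe_add] at h
  -- Here `w = -2(1 - xy)` and `v = -w⁻¹`, so `R_x(v) = 2xv` is `x / (1 - xy)`.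
  set w := -(one F + one F) + mulEnd x y with hw
  have hwU : IsU w := isU_one.double.neg.add_nonU (by
    rw [mulEnd_comm]; exact mulEnd_mem_nonU _ hx)
  have hv := mul_τ hwU
  rw [← τ_isSwap.coe_toR hwU, ← coe_mulEnd] at h
  set v := toR F (τ F • w.pt)
  refine ⟨mulEnd x v, ?_, ?_, h⟩
  · rw [mulEnd_comm]; exact mulEnd_mem_nonU _ hx
  · rw [hw, mulEnd_eq, ← one_def] at hv
    rw [mulEnd_eq]
    linear_combination (-x) * hv

variable (F) in
/-- The bijection from `X` to the projective line. -/
def toP1 (p : X) : P1 F.R :=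
  open Classical in
  -- The second coordinate `-1` is dictated by `[1, x] τ' = [x, -1]`, since `τ` is to become `τ'`.
  if F.M.rel p F.i then P1.mk (toR F (τ F • p)) (-1) isCoprime_one_right.neg_right
  else P1.mk 1 (toR F p) isCoprime_one_left

theorem toP1_pt (x : F.R) : toP1 F x.pt = P1.mk 1 x isCoprime_one_left := by
  rw [toP1, if_neg x.not_rel]
  simp only [toR_coe]

theorem toP1_τ {x : F.R} (hx : x ∈ nonU F) :
    toP1 F (τ F • x.pt) = P1.mk x (-1) isCoprime_one_right.neg_right := by
  rw [toP1, if_pos (τ_smul_rel_i hx)]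
  simp only [τ_smul_τ_smul, toR_coe]

theorem toP1_τ_smul (p : X) : toP1 F (τ F • p) = slMap (tauMatrix F.R) (toP1 F p) := by
  obtain ⟨x, rfl⟩ | ⟨x, hx, rfl⟩ := exists_eq_pt (F := F) p
  · rw [toP1_pt, slMap_tauMatrix (h' := isCoprime_one_right.neg_right)]
    by_cases hx : IsU x
    · rw [← τ_isSwap.coe_toR hx, toP1_pt, P1.mk_eq_iff]
      obtain ⟨u, hu⟩ := hx.isUnit
      refine ⟨u, by rw [hu, mul_one], ?_⟩
      rw [hu, mul_τ hx]
    · rw [toP1_τ ((mem_nonU x).2 hx)]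
  · rw [τ_smul_τ_smul, toP1_τ hx, toP1_pt,
      slMap_tauMatrix (h' := isCoprime_one_left.neg_left.neg_right), P1.mk_eq_iff]
    exact ⟨-1, by simp, by simp⟩

theorem toP1_α_smul (hstar : F.M.StarIdentity F.o F.i F.e) (y : F.R) (p : X) :
    toP1 F (α y • p) = slMap (upperMatrix y) (toP1 F p) := by
  obtain ⟨x, rfl⟩ | ⟨x, hx, rfl⟩ := exists_eq_pt (F := F) p
  · rw [← coe_add, toP1_pt, toP1_pt, slMap_upperMatrix (h' := isCoprime_one_left)]
    simp only [one_mul]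
  · obtain ⟨u, hu, hxu, h⟩ := star_eq hstar hx y
    have hunit : IsUnit (1 - x * y) := by
      rw [isUnit_iff, sub_eq_add_neg]
      exact isU_one.add_nonU (neg_mem (mul_mem_nonU hx y))
    obtain ⟨c, hc⟩ := hunit
    have hcop : IsCoprime x (x * y + -1) := ⟨y, -1, by ring⟩
    rw [h, toP1_τ hu, toP1_τ hx, slMap_upperMatrix (h' := hcop), P1.mk_eq_iff]
    -- The factor is `c = 1 - xy`: `[x, -1]` is sent to `[x, xy - 1] = [cu, -c]`.
    exact ⟨c, by rw [hc, hxu], by rw [hc]; ring⟩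

theorem toP1_injective : Function.Injective (toP1 F) := by
  have key : ∀ {x y : F.R}, y ∈ nonU F →
      P1.mk 1 x isCoprime_one_left ≠ P1.mk y (-1) isCoprime_one_right.neg_right := by
    intro x y hy h
    obtain ⟨u, hu, -⟩ := (P1.mk_eq_iff _ _).1 h
    rw [mul_one] at hu
    exact isUnit_iff.1 ⟨u, hu.symm⟩ hy
  intro p q h
  obtain ⟨x, rfl⟩ | ⟨x, hx, rfl⟩ := exists_eq_pt (F := F) p <;>
  obtain ⟨y, rfl⟩ | ⟨y, hy, rfl⟩ := exists_eq_pt (F := F) q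
  · rw [toP1_pt, toP1_pt, P1.mk_eq_iff] at h
    obtain ⟨u, h1, h2⟩ := h
    rw [mul_one] at h1
    rw [← h1, one_mul] at h2
    rw [h2]
  · rw [toP1_pt, toP1_τ hy] at h
    exact (key hy h).elim
  · rw [toP1_pt, toP1_τ hx] at h
    exact (key hx h.symm).elim
  · rw [toP1_τ hx, toP1_τ hy, P1.mk_eq_iff] at h
    obtain ⟨u, h1, h2⟩ := h
    have hu : (u : F.R) = 1 := by linear_combination h2
    rw [hu, one_mul] at h1
    rw [h1]

theorem toP1_surjective : Function.Surjective (toP1 F) := by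
  intro p
  obtain ⟨a, b, h, rfl⟩ := P1.exists_mk p
  by_cases ha : IsUnit a
  · obtain ⟨u, rfl⟩ := ha
    refine ⟨(((u⁻¹ : F.Rˣ) : F.R) * b).pt, ?_⟩
    rw [toP1_pt, P1.mk_eq_iff]
    exact ⟨u, by simp, by simp⟩
  · have ha' : a ∈ nonU F := by rwa [mem_nonU, ← isUnit_iff]
    have hb : IsUnit b := by
      obtain ⟨c, d, hcd⟩ := h
      rw [isUnit_iff]
      intro hb
      have := add_mem (mul_mem_nonU ha' c) (mul_mem_nonU hb d)
      rw [mul_comm a, mul_comm b, hcd] at this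
      exact isU_one this
    obtain ⟨u, rfl⟩ := hb
    have hx : -(a * ((u⁻¹ : F.Rˣ) : F.R)) ∈ nonU F := neg_mem (mul_mem_nonU ha' _)
    refine ⟨τ F • (-(a * ((u⁻¹ : F.Rˣ) : F.R))).pt, ?_⟩
    rw [toP1_τ hx, P1.mk_eq_iff]
    exact ⟨-u, by simp [mul_comm a], by simp⟩

theorem toP1_rel (p q : X) : F.M.rel p q ↔ P1.rel F.R (toP1 F p) (toP1 F q) := by
  have hpt : ∀ {x y : F.R}, y ∈ nonU F → ¬ F.M.rel x.pt (τ F • y.pt) := fun {x y} hy h =>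
    x.not_rel (F.M.rel.trans' h (τ_smul_rel_i hy))
  have hP : ∀ {x y : F.R}, y ∈ nonU F → ¬ P1.rel F.R (P1.mk 1 x isCoprime_one_left)
      (P1.mk y (-1) isCoprime_one_right.neg_right) := by
    intro x y hy
    rw [P1.rel_mk, mem_maximalIdeal_iff]
    have := isU_one.neg.add_nonU (neg_mem (mul_mem_nonU hy x))
    rw [← one_def] at this
    rwa [show 1 * -1 - x * y = -1 + -(y * x) by ring]
  obtain ⟨x, rfl⟩ | ⟨x, hx, rfl⟩ := exists_eq_pt (F := F) p <;>
  obtain ⟨y, rfl⟩ | ⟨y, hy, rfl⟩ := exists_eq_pt (F := F) q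
  · rw [toP1_pt, toP1_pt, P1.rel_affine, rel_coe_iff, mem_maximalIdeal_iff, IsU, not_not]
  · rw [toP1_pt, toP1_τ hy]
    exact iff_of_false (hpt hy) (hP hy)
  · rw [toP1_pt, toP1_τ hx]
    exact iff_of_false (fun h => hpt hx (F.M.rel.symm' h))
      fun h => hP hx ((P1.rel F.R).symm' h)
  · rw [toP1_τ hx, toP1_τ hy, P1.rel_mk, mem_maximalIdeal_iff]
    refine iff_of_true (F.M.rel.trans' (τ_smul_rel_i hx) (F.M.rel.symm' (τ_smul_rel_i hy))) ?_
    have := add_mem (neg_mem hx) hy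
    rwa [show x * -1 - -1 * y = -x + y by ring]

/-! ### Correspondence of the root groups. -/

variable (F) in
/-- The bijection from `X` to the projective line, as an equivalence. -/
def equivP1 : X ≃ P1 F.R := Equiv.ofBijective (toP1 F) ⟨toP1_injective, toP1_surjective⟩

variable (F) in
/-- The isomorphism of symmetry groups induced by the bijection to the projective line. -/
def symP1 : F.Sym ≃* SymRel (P1.rel F.R) := symEquiv (equivP1 F) toP1_rel

theorem symP1_eq {g : F.Sym} {A : SL(2, F.R)}
    (h : ∀ p, toP1 F (g • p) = slMap A (toP1 F p)) :
    symP1 F g = (pslHom (QuotientGroup.mk A)).unop := by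
  apply Subtype.ext
  ext q
  obtain ⟨p, rfl⟩ := (equivP1 F).surjective q
  exact (symEquiv_smul (equivP1 F) toP1_rel g p).trans (h p)

theorem symP1_τ : symP1 F (τ F) = (pslHom (projTau F.R)).unop := symP1_eq toP1_τ_smul

theorem toP1_i : toP1 F F.i = P1.mk 0 1 isCoprime_one_right := by
  have h0 : (0 : F.R) ∈ nonU F := zero_mem _
  have : F.i = τ F • (0 : F.R).pt := by rw [coe_zero, τ_isSwap.smul_o]
  rw [this, toP1_τ h0, P1.mk_eq_iff]
  exact ⟨-1, by simp, by simp⟩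

theorem map_root_i (hstar : F.M.StarIdentity F.o F.i F.e) :
    (F.M.U F.i).map (symP1 F).toMonoidHom = ((upper F.R).map pslHom).unop := by
  ext g
  constructor
  · rintro ⟨k, hk, rfl⟩
    have hko : ¬ F.M.rel (k • F.o) F.i := (rel_smul_of_mem hk _).not.2 F.hoi
    have : k = α (R.mk F _ hko) := α_unique hk rfl
    refine ⟨_, ⟨R.mk F _ hko, rfl⟩, ?_⟩
    apply MulOpposite.unop_injective
    rw [← symP1_eq (toP1_α_smul hstar (R.mk F _ hko)), ← this]
    rfl
  · rintro ⟨_, ⟨r, rfl⟩, hr⟩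
    refine ⟨α r, α_mem r, ?_⟩
    exact (symP1_eq (toP1_α_smul hstar r)).trans (congrArg MulOpposite.unop hr)

theorem symP1_smul (g : F.Sym) (p : X) : symP1 F g • toP1 F p = toP1 F (g • p) :=
  symEquiv_smul (equivP1 F) toP1_rel g p

/-- The element chosen in the image group need only come from some `a` with `a • p = q`; its
conjugates of root groups depend only on where `a` moves the points. -/
theorem alphaOf_map {p q : X} (hp : ¬ F.M.rel p F.i) (hq : ¬ F.M.rel q F.i) :
    ∃ a ∈ F.M.U F.i, a • p = q ∧
      alphaOf ((F.M.U F.i).map (symP1 F).toMonoidHom) (toP1 F p) (toP1 F q) = symP1 F a := by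
  have h : ∃ g, g ∈ (F.M.U F.i).map (symP1 F).toMonoidHom ∧ g • toP1 F p = toP1 F q := by
    obtain ⟨g, hg, hgp⟩ := exists_root hp hq
    exact ⟨symP1 F g, ⟨g, hg, rfl⟩, by rw [symP1_smul, hgp]⟩
  obtain ⟨⟨a, ha, hag⟩, hap⟩ := h.choose_spec
  refine ⟨a, ha, ?_, ?_⟩
  · rw [← hag] at hap
    exact toP1_injective ((symP1_smul a p).symm.trans hap)
  · rw [alphaOf, dif_pos h, ← hag]
    rfl

/-- The conjugations defining the root groups of `𝕄(R)` pull back to conjugations by elements of the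
little projective group, where axiom `LM2` identifies the result as `U_x`. -/
theorem projective_U (hstar : F.M.StarIdentity F.o F.i F.e) (x : X) :
    (projective F.R).U (toP1 F x) = (F.M.U x).map (symP1 F).toMonoidHom := by
  unfold projective construct
  dsimp only
  rw [← map_root_i hstar, ← symP1_τ, ← toP1_i, symP1_smul, τ_isSwap.smul_i, ← map_inv, symP1_smul]
  by_cases hx : F.M.rel x F.i
  · have hx' : ¬ F.M.rel ((τ F)⁻¹ • x) F.i := by
      rw [τ_isSwap.inv.rel_i]
      exact fun h => F.hoi (F.M.rel.trans' (F.M.rel.symm' h) hx)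
    rw [if_pos ((toP1_rel _ _).1 hx)]
    obtain ⟨a, ha, hax, h⟩ := alphaOf_map F.hoi hx'
    have hG : τ F * a * (τ F)⁻¹ ∈ F.M.G :=
      mul_mem (mul_mem τ_isSwap.mem (root_le_G _ ha)) (inv_mem τ_isSwap.mem)
    rw [h, ← map_mul, ← map_mul]
    refine (conjBy_map (symP1 F) _ _).trans ?_
    rw [F.hM.LM2 _ _ hG, mul_smul, τ_isSwap.inv.smul_i,
      mul_smul, hax, smul_inv_smul]
  · rw [if_neg ((toP1_rel _ _).not.1 hx)]
    obtain ⟨a, ha, hax, h⟩ := alphaOf_map F.hoi hx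
    rw [h, conjBy_map, conjBy_map, F.hM.LM2 _ _ τ_isSwap.mem, F.hM.LM2 _ _ (root_le_G _ ha),
      τ_isSwap.smul_i, hax]

theorem projective_isLocalMoufangSet (hstar : F.M.StarIdentity F.o F.i F.e) :
    (projective F.R).IsLocalMoufangSet :=
  F.hM.transport (N := projective F.R) (equivP1 F) toP1_rel (projective_U hstar)

theorem isomorphic_projective (hstar : F.M.StarIdentity F.o F.i F.e) :
    Isomorphic F.M (projective F.R) := by
  refine ⟨toP1 F, ⟨toP1_injective, toP1_surjective⟩, toP1_rel, fun x g hg => ?_⟩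
  refine ⟨symP1 F g, ?_, fun y => (symP1_smul g y).symm⟩
  rw [projective_U hstar]
  exact ⟨g, hg, rfl⟩

end Frame

end LocalMoufang

end

theorem mainTheorem7 {X : Type u} (M : LocalMoufang.Data X) (hM : M.IsLocalMoufangSet)
    (o i : X) (hoi : ¬ M.rel o i)
    (t : X) (ht : M.IsUnitPt o i t) (hR : M.SatisfiesR o i (M.mu o i t))
    (e : X) (he : M.IsUnitPt o i e) (hstar : M.StarIdentity o i e) :
    ∃ (_ : CommRing (M.RingCarrier i)) (_ : IsLocalRing (M.RingCarrier i)),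
      M.IsConstructedRing o i e ∧
      (LocalMoufang.projective (M.RingCarrier i)).IsLocalMoufangSet ∧
      LocalMoufang.Isomorphic M (LocalMoufang.projective (M.RingCarrier i)) := by
  let F : LocalMoufang.Frame X := ⟨M, hM, o, i, hoi, t, ht, hR, e, he⟩
  refine ⟨(inferInstance : CommRing F.R), (inferInstance : IsLocalRing F.R),
    @LocalMoufang.Data.IsConstructedRing.mk X M o i e (inferInstance : CommRing F.R)
      (LocalMoufang.Frame.coe_add_eq (F := F)) (LocalMoufang.Frame.coe_mul_eq (F := F))
      (LocalMoufang.Frame.coe_zero (F := F)) rfl,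
    LocalMoufang.Frame.projective_isLocalMoufangSet (F := F) hstar,
    LocalMoufang.Frame.isomorphic_projective (F := F) hstar⟩
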